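/- Let $L(s)=\sum_{n\ge1}a_nn^{-s}$ be a Dirichlet series with $a_n=O_\varepsilon(n^\varepsilon)$ for every $\varepsilon>0$, and let $\sigma_0<1$ be such that $L$ has a meromorphic continuation to $\Re s>\sigma_0$ with a unique pole, of order $m\ge1$, at $s=1$, and $(s-1)^mL(s)$ is analytic of finite order in $\Re s>\sigma_0$ (i.e. $|(s-1)^mL(s)|\le\exp(|s|^{\rho})$ for some $\rho$ and all $s$ there with $|s|$ large). Let $\varphi:[0,\infty)\to\mathbb C$ be measurable, supported on $[0,1]$, locally bounded on $(0,1)$, with $\varphi(x)=O(x^{-\sigma_0})$ as $x\to0^+$ and $\varphi(x)=O((1-x)^{-\sigma_1})$ as $x\to1^-$ for some $\sigma_1<1/2$. Put $\widehat\varphi(s)=\int_0^\infty\varphi(t)t^{s-1}\,dt$ and $$\psi(u)=\operatorname{Res}_{s=1}\bigl(L(s)\widehat\varphi(s)u^s\bigr)-\sum_{1\le n<u}a_n\varphi(n/u)\qquad(u>0).$$ Assume that $r_0>\sigma_0$ satisfies $r_0<1$ and $\int_1^\infty|\psi(t)|^2t^{-1-2r_0}\,dt<\infty$. Let $r_0\le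 r<1$ and $\lambda\in\mathbb C$ with $\Re\lambda>\sigma_0$. Let $X=L^2\bigl((0,\infty),t^{2\sigma_0-1}dt\bigr)$. For $\ell\ge1$, $\alpha\in(0,1]^\ell$, $c\in\mathbb C^\ell$ and $A=(\alpha,c)$, set $f_{A,r}(t)=t^{r-\sigma_0}\sum_{j=1}^{\ell}c_j\psi(\alpha_j/t)$ for $t>0$. With $a=2-2r$ and $b=r+\sigma_0-1-\overline\lambda$, set, for $t>0$, $$u_{r,\lambda}(t)=\Bigl(1+\frac ab\Bigr)^{m}t^{\overline\lambda-2\sigma_0}\chi_{(0,1)}(t)+Q_{r,\lambda}(\log t)\,t^{r-\sigma_0-1}\chi_{(1,\infty)}(t),$$ $$Q_{r,\lambda}(x)=\sum_{j=0}^{m-1}\Bigl(\sum_{k=0}^{m-1-j}\binom mk\Bigl(\frac ab\Bigr)^{m-k}\Bigr)\frac{(-1)^jb^j}{j!}x^j .$$ Then all the functions $f_{A,r}$ and $u_{r,\lambda}$ belong to $X$. Let $K_r$ be the closed linear span of all the $f_{A,r}$ in $X$, let $\delta_r(\lambda)$ be the distance in $X$ from $u_{r,\lambda}$ to $K_r$,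 and let $$D_r(\lambda)=\Bigl\{\mu\in\mathbb C:\ \mu\ne2\sigma_0-\overline\lambda,\ \Bigl|\frac{\mu-\lambda}{\mu+\overline\lambda-2\sigma_0}\Bigr|<\sqrt{1-2(\Re\lambda-\sigma_0)\,\delta_r(\lambda)^2}\Bigr\},$$ where the square root is read as $0$ if its argument is negative. Then $r-\sigma_0+D_r(\lambda)$ is contained in the half-plane $\Re s>\sigma_0$, and $L$ has no zero in it. -/

import Mathlib

open Complex MeasureTheory Set Filter Topology
open scoped ComplexConjugate

noncomputable section

namespace ZeroFree

/-- The open half-plane `Re s > r`. -/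
def halfPlane (r : ℝ) : Set ℂ := {s : ℂ | r < s.re}

/-- The Dirichlet series `∑_{n ≥ 1} a_n n^{-s}` has coefficients `a_n = O_ε(n^ε)` for all `ε > 0`,
and `L` is its meromorphic continuation to `Re s > σ₀` (where `σ₀ < 1`), with a unique pole, of
order `m`, at `s = 1`, such that `(s - 1)^m L(s)` has finite order in `Re s > σ₀`.
The values of `L` at `1` and outside the half-plane are irrelevant. -/
structure IsDirichletContinuation (a : ℕ → ℂ) (L : ℂ → ℂ) (σ₀ : ℝ) (m : ℕ) : Prop where
  coeff_bound : ∀ ε : ℝ, 0 < ε → a =O[atTop] fun n : ℕ => (n : ℝ) ^ ε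
  abscissa_lt_one : σ₀ < 1
  eq_series : ∀ s : ℂ, 1 < s.re → L s = LSeries a s
  analytic : AnalyticOnNhd ℂ L (halfPlane σ₀ \ {1})
  one_le_order : 1 ≤ m
  pole : meromorphicOrderAt L 1 = -(m : ℤ)
  finite_order : ∃ ρ R : ℝ, ∀ s ∈ halfPlane σ₀, R ≤ ‖s‖ →
    ‖(s - 1) ^ m * L s‖ ≤ Real.exp (‖s‖ ^ ρ)

/-- The conditions on the weight `φ : [0, ∞) → ℂ` (its values at negative reals are irrelevant). -/
structure IsWeight (φ : ℝ → ℂ) (σ₀ : ℝ) : Prop where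
  aemeasurable : AEMeasurable φ (volume.restrict (Ioi 0))
  support : ∀ x : ℝ, 1 < x → φ x = 0
  locally_bounded : ∀ x ∈ Ioo (0 : ℝ) 1, ∃ C : ℝ, ∀ᶠ y in 𝓝 x, ‖φ y‖ ≤ C
  at_zero : φ =O[𝓝[>] 0] fun x : ℝ => x ^ (-σ₀)
  at_one : ∃ σ₁ : ℝ, σ₁ < 1 / 2 ∧ φ =O[𝓝[<] 1] fun x : ℝ => (1 - x) ^ (-σ₁)

/-- The residue of `F` at an isolated singularity `z₀`: the value of `(2πi)⁻¹ ∮ F` over all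
sufficiently small circles around `z₀`. -/
def residue (F : ℂ → ℂ) (z₀ : ℂ) : ℂ :=
  limUnder (𝓝[>] (0 : ℝ)) fun ρ => (2 * Real.pi * I)⁻¹ * ∮ z in C(z₀, ρ), F z

/-- `ψ(u) = Res_{s=1} (L(s) φ̂(s) u^s) - ∑_{1 ≤ n < u} a_n φ(n/u)` for `u > 0`, where
`φ̂(s) = ∫_0^∞ φ(t) t^{s-1} dt` is the Mellin transform. -/
def psi (a : ℕ → ℂ) (L : ℂ → ℂ) (φ : ℝ → ℂ) (u : ℝ) : ℂ :=
  residue (fun s => L s * mellin φ s * (u : ℂ) ^ s) 1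
    - ∑ n ∈ Finset.Ico 1 ⌈u⌉₊, a n * φ (n / u)

/-- The measure `dt / t^{1 - 2σ₀}` on `(0, ∞)`. -/
def weightMeasure (σ₀ : ℝ) : Measure ℝ :=
  (volume.restrict (Ioi 0)).withDensity fun t => ENNReal.ofReal (1 / t ^ (1 - 2 * σ₀))

/-- The Hilbert space `L²((0, ∞), dt / t^{1 - 2σ₀})`. -/
abbrev WeightedL2 (σ₀ : ℝ) : Type := Lp ℂ 2 (weightMeasure σ₀)

open Classical in
/-- The class in `L²((0, ∞), dt / t^{1 - 2σ₀})` of a square integrable function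
(and `0` for any other function). -/
def toL2 (σ₀ : ℝ) (f : ℝ → ℂ) : WeightedL2 σ₀ :=
  if h : MemLp f 2 (weightMeasure σ₀) then h.toLp f else 0

/-- The set of all pairs `(α, c) ∈ (0, 1]^ℓ × ℂ^ℓ`, over all lengths `ℓ ≥ 1`. -/
structure FiniteSeq where
  len : ℕ
  one_le_len : 1 ≤ len
  α : Fin len → ℝ
  α_mem : ∀ j, α j ∈ Ioc (0 : ℝ) 1
  c : Fin len → ℂ

/-- `f_{A,r}(t) = t^{r - σ₀} ∑_j c_j ψ(α_j / t)`. -/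
def fA (a : ℕ → ℂ) (L : ℂ → ℂ) (φ : ℝ → ℂ) (σ₀ r : ℝ) (A : FiniteSeq) (t : ℝ) : ℂ :=
  ((t ^ (r - σ₀) : ℝ) : ℂ) * ∑ j, A.c j * psi a L φ (A.α j / t)

/-- `K_r`, the closed linear span of all `f_{A,r}` in `L²((0, ∞), dt / t^{1 - 2σ₀})`. -/
def K (a : ℕ → ℂ) (L : ℂ → ℂ) (φ : ℝ → ℂ) (σ₀ r : ℝ) : Submodule ℂ (WeightedL2 σ₀) :=
  (Submodule.span ℂ (range fun A : FiniteSeq => toL2 σ₀ (fA a L φ σ₀ r A))).topologicalClosure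

/-- The number `A = 2 - 2r`. -/
def constA (r : ℝ) : ℂ := 2 - 2 * r

/-- The number `B = r + σ₀ - 1 - conj λ`. -/
def constB (σ₀ r : ℝ) (lam : ℂ) : ℂ := r + σ₀ - 1 - conj lam

/-- The polynomial `Q_{r,λ}`, normalized so that the Mellin transform of `u_{r,λ}` is
`(s - 2σ₀ + conj λ)⁻¹ ((s - r - σ₀ + 1) / (s + r - σ₀ - 1))^m`. -/
def Q (m : ℕ) (σ₀ r : ℝ) (lam : ℂ) (x : ℂ) : ℂ :=
  ∑ j ∈ Finset.range m,
    (∑ k ∈ Finset.range (m - j),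
        (m.choose k : ℂ) * (constA r / constB σ₀ r lam) ^ (m - k))
      * ((-1) ^ j * constB σ₀ r lam ^ j / (j.factorial : ℂ)) * x ^ j

/-- The function `u_{r,λ}` on `(0, ∞)`. -/
def uFun (m : ℕ) (σ₀ r : ℝ) (lam : ℂ) (t : ℝ) : ℂ :=
  (1 + constA r / constB σ₀ r lam) ^ m * (t : ℂ) ^ (conj lam - 2 * σ₀)
      * (Ioo (0 : ℝ) 1).indicator 1 t
    + Q m σ₀ r lam (Real.log t) * ((t ^ (r - σ₀ - 1) : ℝ) : ℂ) * (Ioi (1 : ℝ)).indicator 1 t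

/-- `δ_r(λ)`, the distance from `u_{r,λ}` to `K_r` in `L²((0, ∞), dt / t^{1 - 2σ₀})`. -/
def delta (a : ℕ → ℂ) (L : ℂ → ℂ) (φ : ℝ → ℂ) (m : ℕ) (σ₀ r : ℝ) (lam : ℂ) : ℝ :=
  Metric.infDist (toL2 σ₀ (uFun m σ₀ r lam)) (K a L φ σ₀ r : Set (WeightedL2 σ₀))

/-- The pseudo-hyperbolic disc `D_r(λ)`. The point where the quotient is undefined is not in it. -/
def disc (a : ℕ → ℂ) (L : ℂ → ℂ) (φ : ℝ → ℂ) (m : ℕ) (σ₀ r : ℝ) (lam : ℂ) : Set ℂ :=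
  {μ : ℂ | μ + conj lam - 2 * σ₀ ≠ 0 ∧
    ‖(μ - lam) / (μ + conj lam - 2 * σ₀)‖ <
      Real.sqrt (1 - 2 * (lam.re - σ₀) * delta a L φ m σ₀ r lam ^ 2)}

end ZeroFree

end

/-!
The Mellin transform carries `L²((0, ∞), t^{2σ₀-1} dt)` to `L²` of the line `Re s = σ₀`. Under it the
function `f_{A,r}` becomes an exponential sum times `-L(w) φ̂(w)`, `w = s + r - σ₀`, and multiplying by
the `m`-th power of the Blaschke factor which vanishes at `w = 1` moves it into the Hardy space of
`Re s > σ₀`; the same isometry carries `u_{r,λ}` to the reproducing kernel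
`k_λ(s) = 1 / (s - 2σ₀ + conj λ)`. If `L` vanishes at `μ + r - σ₀`, all these transforms vanish at `μ`,
that is, they are orthogonal to `k_μ`, so the distance `δ` from `k_λ` to their span is at least
`|⟨k_μ, k_λ⟩| / ‖k_μ‖`. This reads
`2 (Re λ - σ₀) δ² ≥ 1 - |(μ - λ) / (μ + conj λ - 2σ₀)|²`, which puts `μ` outside the disc.

The proof below uses only two inner products, which are computed directly, without the Plancherel
theorem and without growth estimates for `L`:

* `⟨u_{r,μ}, u_{r,λ}⟩ = 1 / (μ + conj λ - 2σ₀)` (`inner_uFun_uFun`);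
* `⟨u_{r,μ}, t^{r-σ₀} ψ(α/t)⟩ = 0` for `α ≤ 1` if `L (μ + r - σ₀) = 0` (`inner_uFun_psiDilate`).

For `u ≤ 1` one has `ψ(u) = u P(log u)` with a polynomial `P` of degree less than `m`
(`exists_psi_eq`), so on `(1, ∞)` all the functions involved are polynomials in `log t` times a power
of `t`. Integrals of such functions are values of the linear functional `laplace s`, `X^k ↦ k!/s^{k+1}`,
on polynomials. On `(0, 1)` the second inner product involves `∫_α^∞ ψ(u) u^{-w-1} du` with
`w = μ + r - σ₀`. Termwise integration for `Re w > 1` and the identity theorem give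
`∫_1^∞ ψ(u) u^{-w-1} du = laplace (w - 1) P - L(w) φ̂(w)` for `Re w > r₀`, `w ≠ 1`
(`integral_cpow_mul_psi`). At a zero of `L` only the first term remains, and both inner products become
identities for `laplace` (`laplace_add_laplace_comp_neg_mul_qPoly`, `laplace_qPoly_mul_qPoly`). These
follow by integration by parts from the differential equation `q' + b q = ℓ` for the polynomial `q` in
the definition of `u_{r,λ}`, whose right-hand side `ℓ` is a Laguerre polynomial.
-/

open Complex MeasureTheory Set Filter Topology
open scoped ComplexConjugate

noncomputable section

namespace ZeroFree

/-! ### The formal Laplace transform on polynomials -/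

open Polynomial in
/-- The formal Laplace transform at `s` of a complex polynomial: the linear functional with
`X ^ k ↦ k! / s ^ (k + 1)`. For `0 < Re s` it is `∫_0^∞ p(x) e^{-sx} dx`; for `s ≠ 0` it is the
meromorphic continuation of that integral. -/
def laplace (s : ℂ) : ℂ[X] →ₗ[ℂ] ℂ :=
  Polynomial.lsum fun k => LinearMap.mulLeft ℂ ((k.factorial : ℂ) / s ^ (k + 1))

lemma laplace_C_mul_X_pow (s c : ℂ) (k : ℕ) :
    laplace s (Polynomial.C c * Polynomial.X ^ k) = c * ((k.factorial : ℂ) / s ^ (k + 1)) := by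
  rw [Polynomial.C_mul_X_pow_eq_monomial, laplace, Polynomial.lsum_apply,
    Polynomial.sum_monomial_index]
  · simp [mul_comm]
  · simp

/-- Integration by parts for the formal Laplace transform. -/
lemma laplace_derivative {s : ℂ} (hs : s ≠ 0) (p : Polynomial ℂ) :
    laplace s p.derivative = s * laplace s p - p.eval 0 := by
  induction p using Polynomial.induction_on' with
  | add p q hp hq => simp only [map_add, hp, hq, Polynomial.eval_add]; ring
  | monomial n c =>
    rw [← Polynomial.C_mul_X_pow_eq_monomial, Polynomial.derivative_C_mul_X_pow,
      laplace_C_mul_X_pow, laplace_C_mul_X_pow]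
    cases n with
    | zero => simp; field_simp; simp
    | succ n =>
      simp only [Nat.factorial_succ, Nat.add_sub_cancel, Polynomial.eval_mul, Polynomial.eval_C,
        Polynomial.eval_pow, Polynomial.eval_X]
      push_cast
      field_simp
      simp
      ring

/-- For `s ≠ 0` every polynomial `p` is `s R - R'` for a polynomial `R` of no larger degree. -/
lemma exists_smul_sub_derivative {s : ℂ} (hs : s ≠ 0) {m : ℕ} {p : Polynomial ℂ}
    (hp : p ∈ Polynomial.degreeLT ℂ m) :
    ∃ R ∈ Polynomial.degreeLT ℂ m, p = Polynomial.C s * R - R.derivative := by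
  induction m generalizing p with
  | zero =>
    refine ⟨0, by simp, ?_⟩
    have : p = 0 := by simpa [Polynomial.mem_degreeLT] using hp
    simp [this]
  | succ m ih =>
    have hd : p.derivative ∈ Polynomial.degreeLT ℂ m := by
      rw [Polynomial.mem_degreeLT, Polynomial.degree_lt_iff_coeff_zero]
      intro k hk
      rw [Polynomial.mem_degreeLT, Polynomial.degree_lt_iff_coeff_zero] at hp
      rw [Polynomial.coeff_derivative, hp (k + 1) (by omega), zero_mul]
    obtain ⟨R, hR, hpR⟩ := ih hd
    have hR' : R ∈ Polynomial.degreeLT ℂ (m + 1) :=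
      Polynomial.degreeLT_mono (Nat.le_succ m) hR
    refine ⟨Polynomial.C s⁻¹ * (p + R), ?_, ?_⟩
    · rw [← Polynomial.smul_eq_C_mul]
      exact Submodule.smul_mem _ _ (Submodule.add_mem _ hp hR')
    · rw [← mul_assoc, ← Polynomial.C_mul, mul_inv_cancel₀ hs, Polynomial.C_1, one_mul,
        Polynomial.derivative_C_mul, Polynomial.derivative_add, hpR, sub_add_cancel, ← mul_assoc,
        ← Polynomial.C_mul, inv_mul_cancel₀ hs]
      simp

lemma laplace_smul_sub_derivative {s : ℂ} (hs : s ≠ 0) (R : Polynomial ℂ) :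
    laplace s (Polynomial.C s * R - R.derivative) = R.eval 0 := by
  rw [map_sub, laplace_derivative hs, ← Polynomial.smul_eq_C_mul, map_smul, smul_eq_mul]
  ring

/-- The polynomial whose formal Laplace transform at `s` is `1 - (1 - a / s) ^ m`
(a Laguerre polynomial up to normalization). -/
def laguerre (m : ℕ) (a : ℂ) : Polynomial ℂ :=
  ∑ j ∈ Finset.range m, Polynomial.C
    (-((m.choose (j + 1) : ℂ) * (-a) ^ (j + 1)) / (j.factorial : ℂ)) * Polynomial.X ^ j

/-- The polynomial `Q_{r,λ}`, as a function of the two numbers `a` and `b`. -/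
def qPoly (m : ℕ) (a b : ℂ) : Polynomial ℂ :=
  ∑ j ∈ Finset.range m, Polynomial.C
    ((∑ k ∈ Finset.range (m - j), (m.choose k : ℂ) * (a / b) ^ (m - k))
      * ((-1) ^ j * b ^ j / (j.factorial : ℂ))) * Polynomial.X ^ j

lemma qPoly_mem_degreeLT (m : ℕ) (a b : ℂ) : qPoly m a b ∈ Polynomial.degreeLT ℂ m := by
  refine Submodule.sum_mem _ fun j hj => ?_
  rw [Polynomial.mem_degreeLT]
  exact (Polynomial.degree_C_mul_X_pow_le _ _).trans_lt (by exact_mod_cast Finset.mem_range.1 hj)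

lemma qPoly_coeff (m : ℕ) (a b : ℂ) (n : ℕ) : (qPoly m a b).coeff n =
    (∑ k ∈ Finset.range (m - n), (m.choose k : ℂ) * (a / b) ^ (m - k))
      * ((-1) ^ n * b ^ n / (n.factorial : ℂ)) := by
  simp only [qPoly, Polynomial.finsetSum_coeff, Polynomial.coeff_C_mul_X_pow, Finset.sum_ite_eq,
    Finset.mem_range]
  split_ifs with h
  · rfl
  · simp [Nat.sub_eq_zero_of_le (not_lt.1 h)]

lemma laguerre_coeff (m : ℕ) (a : ℂ) (n : ℕ) : (laguerre m a).coeff n =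
    -((m.choose (n + 1) : ℂ) * (-a) ^ (n + 1)) / (n.factorial : ℂ) := by
  simp only [laguerre, Polynomial.finsetSum_coeff, Polynomial.coeff_C_mul_X_pow, Finset.sum_ite_eq,
    Finset.mem_range]
  split_ifs with h
  · rfl
  · simp [Nat.choose_eq_zero_of_lt (show m < n + 1 by omega)]

lemma qPoly_eval_zero (m : ℕ) (a b : ℂ) : (qPoly m a b).eval 0 = (1 + a / b) ^ m - 1 := by
  rw [← Polynomial.coeff_zero_eq_eval_zero, qPoly_coeff, add_pow, Finset.sum_range_succ]
  simp [mul_comm]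

/-- The differential equation `q' + b q = ℓ` relating `qPoly` and `laguerre`. -/
lemma derivative_qPoly {b : ℂ} (hb : b ≠ 0) (m : ℕ) (a : ℂ) :
    (qPoly m a b).derivative + Polynomial.C b * qPoly m a b = laguerre m a := by
  ext n
  rw [Polynomial.coeff_add, Polynomial.coeff_derivative, Polynomial.coeff_C_mul, qPoly_coeff,
    qPoly_coeff, laguerre_coeff]
  have hf := Nat.cast_ne_zero (R := ℂ).2 n.factorial_ne_zero
  have hn : (n : ℂ) + 1 ≠ 0 := by exact_mod_cast n.succ_ne_zero
  rcases lt_or_ge n m with h | h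
  · obtain ⟨d, rfl⟩ : ∃ d, m = d + (n + 1) := ⟨m - (n + 1), by omega⟩
    rw [show d + (n + 1) - n = d + 1 by omega, show d + (n + 1) - (n + 1) = d by omega,
      Finset.sum_range_succ, show d + (n + 1) - d = n + 1 by omega, Nat.choose_symm_add,
      Nat.factorial_succ]
    push_cast
    rw [neg_pow a, div_pow]
    field_simp
    ring
  · simp [Nat.sub_eq_zero_of_le h, Nat.sub_eq_zero_of_le (h.trans n.le_succ),
      Nat.choose_eq_zero_of_lt (show m < n + 1 by omega)]

lemma laplace_laguerre {s : ℂ} (hs : s ≠ 0) (m : ℕ) (a : ℂ) :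
    laplace s (laguerre m a) = 1 - (1 - a / s) ^ m := by
  rw [laguerre, map_sum, sub_eq_add_neg 1 (a/s), add_comm 1, add_pow, Finset.sum_range_succ']
  simp only [laplace_C_mul_X_pow]
  simp only [pow_zero, one_pow, mul_one, Nat.choose_zero_right, Nat.cast_one, sub_add_cancel_right,
    ← Finset.sum_neg_distrib]
  refine Finset.sum_congr rfl fun j _ => ?_
  have := Nat.cast_ne_zero (R := ℂ).2 j.factorial_ne_zero
  rw [← neg_div, div_pow]
  field_simp

/-- Orthogonality: `∫_0^∞ R(x) ℓ(x) e^{-ax} dx = R(0)` if `deg R < m`, by the vanishing of `m`-th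
finite differences in degree less than `m`. -/
lemma laplace_mul_laguerre {a : ℂ} (ha : a ≠ 0) {m : ℕ} {R : Polynomial ℂ}
    (hR : R ∈ Polynomial.degreeLT ℂ m) : laplace a (R * laguerre m a) = R.eval 0 := by
  have key : ∀ i < m, laplace a (Polynomial.X ^ i * laguerre m a) = if i = 0 then 1 else 0 := by
    intro i hi
    -- `(i + j)! / j!` is a polynomial of degree `i < m` in `j + 1`, which vanishes at `0` if `i ≠ 0`;
    -- its `m`-th finite difference at `0` is zero.
    have hdeg : (ascPochhammer ℂ i).natDegree < m := by rwa [ascPochhammer_natDegree]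
    have h0 := congrFun (Polynomial.fwdDiff_iter_eq_zero_of_degree_lt hdeg) 0
    rw [fwdDiff_iter_eq_sum_shift, Finset.sum_range_succ'] at h0
    simp only [Pi.zero_apply, zero_add, nsmul_eq_mul, mul_one, zero_smul, ascPochhammer_eval_zero,
      Nat.sub_zero, Nat.choose_zero_right, Nat.cast_one, zsmul_eq_mul] at h0
    rw [laguerre, Finset.mul_sum, map_sum]
    have hterm : ∀ j ∈ Finset.range m, laplace a (Polynomial.X ^ i * (Polynomial.C
        (-((m.choose (j + 1) : ℂ) * (-a) ^ (j + 1)) / (j.factorial : ℂ)) * Polynomial.X ^ j)) =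
        -((-1) ^ m / a ^ i) * (((-1 : ℤ) ^ (m - (j + 1)) * (m.choose (j + 1) : ℤ) : ℤ)
          * (ascPochhammer ℂ i).eval ((j + 1 : ℕ) : ℂ)) := by
      intro j hj
      have hj := Finset.mem_range.1 hj
      have hfac : ((i + j).factorial : ℂ)
          = j.factorial * (ascPochhammer ℂ i).eval ((j + 1 : ℕ) : ℂ) := by
        rw [← ascPochhammer_eval_cast, ascPochhammer_nat_eq_ascFactorial, add_comm i j,
          ← Nat.factorial_mul_ascFactorial]
        push_cast
        rfl
      have hf := Nat.cast_ne_zero (R := ℂ).2 j.factorial_ne_zero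
      have hs : ((-1 : ℂ)) ^ (j + 1) = (-1) ^ m * (-1) ^ (m - (j + 1)) := by
        obtain ⟨d, rfl⟩ : ∃ d, m = d + (j + 1) := ⟨m - (j + 1), by omega⟩
        rw [Nat.add_sub_cancel, pow_add (-1 : ℂ) d, mul_right_comm, ← mul_pow]
        simp
      rw [mul_left_comm, ← pow_add, laplace_C_mul_X_pow, hfac, neg_pow a, hs]
      push_cast
      field_simp
      ring
    rw [Finset.sum_congr rfl hterm, ← Finset.mul_sum, eq_neg_of_add_eq_zero_left h0]
    split_ifs with hi0
    · subst hi0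
      push_cast
      simp only [pow_zero, div_one, mul_one, neg_mul_neg, ← mul_pow]
      norm_num
    · simp
  have hsum : R = ∑ i ∈ Finset.range m, Polynomial.C (R.coeff i) * Polynomial.X ^ i := by
    rw [Polynomial.mem_degreeLT, Polynomial.degree_lt_iff_coeff_zero] at hR
    ext n
    simp only [Polynomial.finsetSum_coeff, Polynomial.coeff_C_mul_X_pow, Finset.sum_ite_eq,
      Finset.mem_range]
    split_ifs with h
    · rfl
    · exact hR n (not_lt.1 h)
  conv_lhs => rw [hsum, Finset.sum_mul, map_sum]
  rw [← Polynomial.coeff_zero_eq_eval_zero]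
  have : ∀ i ∈ Finset.range m,
      laplace a (Polynomial.C (R.coeff i) * Polynomial.X ^ i * laguerre m a)
        = if i = 0 then R.coeff i else 0 := by
    intro i hi
    rw [mul_assoc, ← Polynomial.smul_eq_C_mul, map_smul, key i (Finset.mem_range.1 hi)]
    simp
  rw [Finset.sum_congr rfl this, Finset.sum_ite_eq']
  split_ifs with h
  · rfl
  · obtain rfl : m = 0 := by simpa using h
    rw [hsum, Finset.range_zero, Finset.sum_empty, Polynomial.coeff_zero]

/-- With `s = -(a + c)`, write `p = s R - R'`, so that `laplace s p = R(0)`. The second term is the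
integral of `p(-x) q(x) e^{-ax}`, which integration by parts and `q' + c q = ℓ` reduce to
`-R(0) q(0) - ∫_0^∞ R(-x) ℓ(x) e^{-ax} dx = -R(0) (q(0) + 1)`, and `q(0) + 1 = (1 + a/c)^m`. -/
lemma laplace_add_laplace_comp_neg_mul_qPoly {a c : ℂ} (ha : a ≠ 0) (hc : c ≠ 0) (hac : a + c ≠ 0)
    {m : ℕ} {p : Polynomial ℂ} (hp : p ∈ Polynomial.degreeLT ℂ m) :
    (1 + a / c) ^ m * laplace (-(a + c)) p
      + laplace a (p.comp (-Polynomial.X) * qPoly m a c) = 0 := by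
  obtain ⟨R, hR, rfl⟩ := exists_smul_sub_derivative (neg_ne_zero.2 hac) hp
  rw [laplace_smul_sub_derivative (neg_ne_zero.2 hac)]
  set S := R.comp (-Polynomial.X) with hS
  have hSm : S ∈ Polynomial.degreeLT ℂ m := by
    rw [Polynomial.mem_degreeLT] at hR ⊢
    rwa [hS, Polynomial.degree_comp_neg_X]
  have h1 : (Polynomial.C (-(a + c)) * R - R.derivative).comp (-Polynomial.X) * qPoly m a c
      = (S * qPoly m a c).derivative - Polynomial.C a * (S * qPoly m a c)
        - S * laguerre m a := by
    rw [← derivative_qPoly hc, Polynomial.derivative_mul, hS, Polynomial.derivative_comp]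
    simp
    ring
  rw [h1, map_sub, map_sub, laplace_derivative ha, laplace_mul_laguerre ha hSm,
    ← Polynomial.smul_eq_C_mul, map_smul, Polynomial.eval_mul, qPoly_eval_zero]
  simp [hS]
  ring

lemma laplace_qPoly {a b s : ℂ} (hb : b ≠ 0) (hs : s ≠ 0) (hsb : s + b ≠ 0) (m : ℕ) :
    laplace s (qPoly m a b) = ((1 + a / b) ^ m - (1 - a / s) ^ m) / (s + b) := by
  have h := congrArg (laplace s) (derivative_qPoly hb m a)
  rw [map_add, laplace_derivative hs, ← Polynomial.smul_eq_C_mul, map_smul, laplace_laguerre hs,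
    qPoly_eval_zero, smul_eq_mul] at h
  rw [eq_div_iff hsb]
  linear_combination h

lemma laplace_comp_neg (s : ℂ) (p : Polynomial ℂ) :
    laplace s (p.comp (-Polynomial.X)) = -laplace (-s) p := by
  induction p using Polynomial.induction_on' with
  | add p q hp hq => rw [Polynomial.add_comp, map_add, map_add, hp, hq]; ring
  | monomial n c =>
    rw [← Polynomial.C_mul_X_pow_eq_monomial, Polynomial.mul_comp, Polynomial.pow_comp,
      Polynomial.X_comp, Polynomial.C_comp, neg_pow, ← Polynomial.C_1, ← Polynomial.C_neg,
      ← Polynomial.C_pow, ← mul_assoc, ← Polynomial.C_mul,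
      laplace_C_mul_X_pow, laplace_C_mul_X_pow]
    rw [neg_pow s, pow_succ (-1 : ℂ)]
    rcases neg_one_pow_eq_or ℂ n with h | h <;> rw [h] <;> simp [div_neg]

/-- The integral `∫_0^∞ q_b(x) q_c(x) e^{-ax} dx`, by `laplace_add_laplace_comp_neg_mul_qPoly` for
`p(x) = q_b(-x)`. -/
lemma laplace_qPoly_mul_qPoly {a b c : ℂ} (ha : a ≠ 0) (hb : b ≠ 0) (hc : c ≠ 0)
    (hac : a + c ≠ 0) (habc : a + b + c ≠ 0) (m : ℕ) :
    laplace a (qPoly m a b * qPoly m a c)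
      = ((1 + a / b) ^ m * (1 + a / c) ^ m - 1) / (a + b + c) := by
  have hmem : (qPoly m a b).comp (-Polynomial.X) ∈ Polynomial.degreeLT ℂ m := by
    have := qPoly_mem_degreeLT m a b
    rw [Polynomial.mem_degreeLT] at this ⊢
    rwa [Polynomial.degree_comp_neg_X]
  have h := laplace_add_laplace_comp_neg_mul_qPoly ha hc hac hmem
  have h2 : ((qPoly m a b).comp (-Polynomial.X)).comp (-Polynomial.X) = qPoly m a b := by
    rw [Polynomial.comp_assoc]; simp
  rw [h2, laplace_comp_neg, neg_neg,
    laplace_qPoly hb hac (by convert habc using 1; ring)] at h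
  have h3 : (1 + a / c) * (1 - a / (a + c)) = 1 := by field_simp; ring
  have h4 : (1 + a / c) ^ m * (1 - a / (a + c)) ^ m = 1 := by rw [← mul_pow, h3, one_pow]
  have h5 : a + c + b = a + b + c := by ring
  rw [h5] at h
  rw [eq_div_iff habc]
  have h6 : laplace a (qPoly m a b * qPoly m a c) = (1 + a / c) ^ m *
    (((1 + a / b) ^ m - (1 - a / (a + c)) ^ m) / (a + b + c)) := by linear_combination h
  rw [h6, ← mul_div_assoc, div_mul_cancel₀ _ habc]
  linear_combination -h4

/-! ### Integrals of polynomials in the logarithm, and residues -/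

lemma hasDerivAt_cpow_mul_eval_log (s : ℂ) (R : Polynomial ℂ) {u : ℝ} (hu : 0 < u) :
    HasDerivAt (fun u : ℝ => -((u : ℂ) ^ (-s) * R.eval (Real.log u : ℂ)))
      ((u : ℂ) ^ (-s - 1) * (Polynomial.C s * R - R.derivative).eval (Real.log u : ℂ)) u := by
  have hu' : (u : ℂ) ≠ 0 := ofReal_ne_zero.2 hu.ne'
  have h1 : HasDerivAt (fun u : ℝ => (u : ℂ) ^ (-s)) (-s * (u : ℂ) ^ (-s - 1)) u := by
    by_cases hs : s = 0
    · simpa [hs] using hasDerivAt_const u (1 : ℂ)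
    · exact hasDerivAt_ofReal_cpow_const hu.ne' (neg_ne_zero.2 hs)
  have h2 : HasDerivAt (fun u : ℝ => R.eval (Real.log u : ℂ))
      (R.derivative.eval (Real.log u : ℂ) * ((u⁻¹ : ℝ) : ℂ)) u :=
    (R.hasDerivAt _).comp u (Real.hasDerivAt_log hu.ne').ofReal_comp
  convert! (h1.mul h2).neg using 1
  rw [cpow_sub _ _ hu', cpow_one]
  simp only [Polynomial.eval_sub, Polynomial.eval_mul, Polynomial.eval_C]
  push_cast
  field_simp
  ring

lemma continuousOn_cpow_mul_eval_log (s : ℂ) (P : Polynomial ℂ) :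
    ContinuousOn (fun u : ℝ => (u : ℂ) ^ s * P.eval (Real.log u : ℂ)) (Ioi 0) := by
  intro u hu
  have hu : (0 : ℝ) < u := hu
  refine ContinuousAt.continuousWithinAt (ContinuousAt.mul ?_ ?_)
  · exact continuousAt_ofReal_cpow_const _ _ (Or.inr hu.ne')
  · exact P.continuous.continuousAt.comp
      (continuous_ofReal.continuousAt.comp (Real.continuousAt_log hu.ne'))

lemma isLittleO_eval_log (P : Polynomial ℂ) {ε : ℝ} (hε : 0 < ε) :
    (fun u : ℝ => P.eval (Real.log u : ℂ)) =o[atTop] fun u : ℝ => u ^ ε := by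
  induction P using Polynomial.induction_on' with
  | add p q hp hq => simpa only [Polynomial.eval_add] using hp.add hq
  | monomial n c =>
    simp only [Polynomial.eval_monomial]
    refine Asymptotics.IsLittleO.const_mul_left ?_ c
    have h := isLittleO_log_rpow_rpow_atTop (n : ℝ) hε
    simp only [Real.rpow_natCast] at h
    refine Asymptotics.IsLittleO.of_norm_left ?_
    refine h.norm_left.congr_left fun u => ?_
    simp

lemma isBigO_cpow_rpow_re (s : ℂ) :
    (fun u : ℝ => (u : ℂ) ^ s) =O[atTop] fun u : ℝ => u ^ s.re := by
  refine Asymptotics.IsBigO.of_bound 1 ?_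
  filter_upwards [eventually_gt_atTop 0] with u hu
  rw [norm_cpow_eq_rpow_re_of_pos hu, one_mul]
  exact le_abs_self _

lemma integrableOn_cpow_mul_eval_log {s : ℂ} (hs : s.re < -1) (P : Polynomial ℂ) :
    IntegrableOn (fun u : ℝ => (u : ℂ) ^ s * P.eval (Real.log u : ℂ)) (Ioi 1) := by
  obtain ⟨ε, hε, hε'⟩ : ∃ ε : ℝ, 0 < ε ∧ s.re + ε < -1 :=
    ⟨(-1 - s.re) / 2, by linarith, by linarith⟩
  have hloc : LocallyIntegrableOn (fun u : ℝ => (u : ℂ) ^ s * P.eval (Real.log u : ℂ)) (Ici 1) :=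
    ((continuousOn_cpow_mul_eval_log s P).mono fun u (hu : 1 ≤ u) =>
      lt_of_lt_of_le one_pos hu).locallyIntegrableOn measurableSet_Ici
  refine IntegrableOn.mono_set (hloc.integrableOn_of_isBigO_atTop
    (g := fun u : ℝ => u ^ (s.re + ε)) ?_
    ⟨Ioi 1, Ioi_mem_atTop 1, integrableOn_Ioi_rpow_of_lt hε' one_pos⟩) Ioi_subset_Ici_self
  refine ((isBigO_cpow_rpow_re s).mul (isLittleO_eval_log P hε).isBigO).congr' EventuallyEq.rfl ?_
  filter_upwards [eventually_gt_atTop 0] with u hu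
  rw [Real.rpow_add hu]

lemma tendsto_cpow_mul_eval_log {s : ℂ} (hs : s.re < 0) (P : Polynomial ℂ) :
    Tendsto (fun u : ℝ => (u : ℂ) ^ s * P.eval (Real.log u : ℂ)) atTop (𝓝 0) := by
  have h2 := (isBigO_cpow_rpow_re s).mul_isLittleO (isLittleO_eval_log P (neg_pos.2 hs))
  refine (Asymptotics.isLittleO_one_iff ℝ).1 (h2.congr' EventuallyEq.rfl ?_)
  filter_upwards [eventually_gt_atTop 0] with u hu
  rw [← Real.rpow_add hu, add_neg_cancel, Real.rpow_zero]

/-- For `0 < Re s` the formal Laplace transform is a convergent integral, here with `x = log u`. -/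
lemma integral_Ioi_cpow_mul_eval_log {s : ℂ} (hs : 0 < s.re) (P : Polynomial ℂ) :
    ∫ u in Ioi (1 : ℝ), (u : ℂ) ^ (-s - 1) * P.eval (Real.log u : ℂ) = laplace s P := by
  have hs0 : s ≠ 0 := by rintro rfl; simp at hs
  obtain ⟨R, -, rfl⟩ := exists_smul_sub_derivative hs0 (m := P.natDegree + 1) (p := P)
    (Polynomial.mem_degreeLT.2
      (Polynomial.degree_le_natDegree.trans_lt (by exact_mod_cast Nat.lt_succ_self _)))
  have hlim : Tendsto (fun u : ℝ => -((u : ℂ) ^ (-s) * R.eval (Real.log u : ℂ))) atTop (𝓝 0) := by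
    simpa using (tendsto_cpow_mul_eval_log (s := -s) (by simpa using hs) R).neg
  rw [integral_Ioi_of_hasDerivAt_of_tendsto'
    (fun u (hu : 1 ≤ u) => hasDerivAt_cpow_mul_eval_log s R (one_pos.trans_le hu))
    (integrableOn_cpow_mul_eval_log (by simp; linarith) _) hlim, laplace_smul_sub_derivative hs0]
  simp

/-- The integral over `(α, 1]` has no condition on `s`: together with `laplace s P = R(0)` it
continues the integral of the same function over `(α, ∞)` to all `s ≠ 0`, with value
`α^{-s} R(log α)`. -/
lemma integral_Ioc_cpow_mul_eval_log (s : ℂ) (R : Polynomial ℂ) {α : ℝ} (hα : α ∈ Ioc (0 : ℝ) 1) :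
    ∫ u in Ioc α 1, (u : ℂ) ^ (-s - 1)
        * (Polynomial.C s * R - R.derivative).eval (Real.log u : ℂ)
      = (α : ℂ) ^ (-s) * R.eval (Real.log α : ℂ) - R.eval 0 := by
  rw [← intervalIntegral.integral_of_le hα.2, intervalIntegral.integral_eq_sub_of_hasDerivAt
    (f := fun u : ℝ => -((u : ℂ) ^ (-s) * R.eval (Real.log u : ℂ)))]
  · simp; ring
  · intro u hu
    rw [uIcc_of_le hα.2] at hu
    exact hasDerivAt_cpow_mul_eval_log s R (hα.1.trans_le hu.1)
  · refine ContinuousOn.intervalIntegrable ((continuousOn_cpow_mul_eval_log _ _).mono ?_)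
    rw [uIcc_of_le hα.2]
    exact fun u hu => hα.1.trans_le hu.1

/-- Cauchy's formula: the residue of a function with a pole of order at most `n + 1` is a Taylor
coefficient. -/
lemma residue_eq_iteratedDeriv {F G : ℂ → ℂ} {z₀ : ℂ} {n : ℕ} (hG : AnalyticAt ℂ G z₀)
    (hF : ∀ᶠ z in 𝓝[≠] z₀, F z = (1 / (z - z₀) ^ (n + 1)) * G z) :
    residue F z₀ = iteratedDeriv n G z₀ / (n.factorial : ℂ) := by
  obtain ⟨ε₁, hε₁, h1⟩ := Metric.eventually_nhds_iff.1 hG.eventually_analyticAt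
  rw [eventually_nhdsWithin_iff] at hF
  obtain ⟨ε₂, hε₂, h2⟩ := Metric.eventually_nhds_iff.1 hF
  refine Tendsto.limUnder_eq ((tendsto_congr' ?_).2 tendsto_const_nhds)
  have hmem : Ioo (0 : ℝ) (min ε₁ ε₂) ∈ 𝓝[>] (0 : ℝ) := Ioo_mem_nhdsGT (lt_min hε₁ hε₂)
  filter_upwards [hmem] with ρ hρ
  have hd : DifferentiableOn ℂ G (Metric.closedBall z₀ ρ) := fun z hz =>
    (h1 (lt_of_le_of_lt hz (hρ.2.trans_le (min_le_left _ _)))).differentiableAt.differentiableWithinAt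
  have hc := hd.circleIntegral_one_div_sub_center_pow_smul hρ.1 n
  have he : (∮ z in C(z₀, ρ), F z) = ∮ z in C(z₀, ρ), (1 / (z - z₀) ^ (n + 1)) • G z := by
    refine circleIntegral.integral_congr hρ.1.le fun z hz => ?_
    have hz' : dist z z₀ = ρ := hz
    refine h2 (hz' ▸ hρ.2.trans_le (min_le_right _ _)) ?_
    rintro rfl
    simp at hz'
    exact hρ.1.ne hz'
  rw [he, hc, smul_eq_mul]
  have := two_pi_I_ne_zero
  field_simp

lemma iteratedDeriv_const_cpow {x : ℂ} (hx : x ≠ 0) (n : ℕ) :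
    iteratedDeriv n (fun s : ℂ => x ^ s) = fun s => log x ^ n * x ^ s := by
  induction n with
  | zero => simp
  | succ n ih =>
    rw [iteratedDeriv_succ, ih]
    ext s
    have h : HasDerivAt (fun s : ℂ => x ^ s) (x ^ s * log x * 1) s :=
      (hasDerivAt_id s).const_cpow (Or.inl hx)
    rw [(h.const_mul _).deriv]
    ring

/-- The residue at `1` of `F(s) u^s`, for `F` with a pole of order at most `m`, is `u` times a
polynomial of degree less than `m` in `log u`. -/
lemma exists_residue_mul_cpow_eq {F G : ℂ → ℂ} {m : ℕ} (hm : 1 ≤ m) (hG : AnalyticAt ℂ G 1)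
    (hF : ∀ᶠ z in 𝓝[≠] (1 : ℂ), F z = (1 / (z - 1) ^ m) * G z) :
    ∃ P ∈ Polynomial.degreeLT ℂ m, ∀ u : ℝ, 0 < u →
      residue (fun s => F s * (u : ℂ) ^ s) 1 = u * P.eval (Real.log u : ℂ) := by
  obtain ⟨n, rfl⟩ : ∃ n, m = n + 1 := ⟨m - 1, by omega⟩
  refine ⟨∑ i ∈ Finset.range (n + 1), Polynomial.C
    ((n.choose i : ℂ) * iteratedDeriv i G 1 / (n.factorial : ℂ)) * Polynomial.X ^ (n - i), ?_, ?_⟩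
  · refine Submodule.sum_mem _ fun j hj => ?_
    rw [Polynomial.mem_degreeLT]
    refine (Polynomial.degree_C_mul_X_pow_le _ _).trans_lt ?_
    exact_mod_cast Nat.lt_succ_of_le (Nat.sub_le n j)
  · intro u hu
    have hu' : (u : ℂ) ≠ 0 := ofReal_ne_zero.2 hu.ne'
    have hpow : AnalyticAt ℂ (fun s : ℂ => (u : ℂ) ^ s) 1 :=
      analyticAt_const.cpow analyticAt_id (Or.inl (by simpa using hu))
    rw [residue_eq_iteratedDeriv (G := G * fun s => (u : ℂ) ^ s) (n := n) (hG.mul hpow)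
      (hF.mono fun z hz => by rw [hz, Pi.mul_apply, mul_assoc])]
    rw [iteratedDeriv_mul hG.contDiffAt hpow.contDiffAt, Finset.sum_div,
      Polynomial.eval_finsetSum, Finset.mul_sum]
    refine Finset.sum_congr rfl fun i _ => ?_
    rw [iteratedDeriv_const_cpow hu', ofReal_log hu.le]
    simp
    ring

/-! ### The Mellin transform of the weighted coefficient sum -/

lemma integrableAtFilter_one_sub_rpow {σ : ℝ} (hσ : σ < 1) :
    IntegrableAtFilter (fun x : ℝ => (1 - x) ^ (-σ)) (𝓝[<] 1) := by
  refine ⟨Ioo 0 1, Ioo_mem_nhdsLT one_pos, ?_⟩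
  have h := (intervalIntegral.intervalIntegrable_rpow' (a := 0) (b := 1) (r := -σ)
    (by linarith)).comp_sub_left 1
  simp only [sub_zero, sub_self] at h
  rw [intervalIntegrable_iff, uIoc_of_ge zero_le_one] at h
  exact h.mono_set Ioo_subset_Ioc_self

lemma IsWeight.ae_eq_zero {φ : ℝ → ℂ} {σ₀ : ℝ} (hφ : IsWeight φ σ₀) :
    φ =ᵐ[volume.restrict (Ici 1)] 0 := by
  rw [← restrict_Ioi_eq_restrict_Ici]
  filter_upwards [ae_restrict_mem measurableSet_Ioi] with x hx
  exact hφ.support x hx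

lemma IsWeight.locallyIntegrableOn {φ : ℝ → ℂ} {σ₀ : ℝ} (hφ : IsWeight φ σ₀) :
    LocallyIntegrableOn φ (Ioi 0) := by
  intro x hx
  have hx : 0 < x := hx
  have hmeas : AEStronglyMeasurable φ (volume.restrict (Ioi 0)) :=
    hφ.aemeasurable.aestronglyMeasurable
  have hIoi : Ioi (0 : ℝ) ∈ 𝓝 x := Ioi_mem_nhds hx
  rw [nhdsWithin_eq_nhds.2 hIoi]
  rcases lt_trichotomy x 1 with h1 | rfl | h1
  · obtain ⟨C, hC⟩ := hφ.locally_bounded x ⟨hx, h1⟩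
    exact (Measure.finiteAt_nhds volume x).integrableAtFilter ⟨Ioi 0, hIoi, hmeas⟩
      (isBoundedUnder_of_eventually_le hC)
  · obtain ⟨σ₁, hσ₁, hO⟩ := hφ.at_one
    rw [← nhdsLT_sup_nhdsGE, IntegrableAtFilter.sup_iff]
    constructor
    · exact hO.integrableAtFilter ⟨Ioi 0, mem_nhdsWithin_of_mem_nhds hIoi, hmeas⟩
        (integrableAtFilter_one_sub_rpow (by linarith))
    · exact ⟨Ici 1, self_mem_nhdsWithin, (integrable_zero _ _ _).congr hφ.ae_eq_zero.symm⟩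
  · exact ⟨Ici 1, Ici_mem_nhds h1, (integrable_zero _ _ _).congr hφ.ae_eq_zero.symm⟩

lemma IsWeight.isBigO_atTop {φ : ℝ → ℂ} {σ₀ : ℝ} (hφ : IsWeight φ σ₀) (τ : ℝ) :
    φ =O[atTop] fun x : ℝ => x ^ (-τ) := by
  refine (Asymptotics.isBigO_zero _ _).congr' ?_ EventuallyEq.rfl
  filter_upwards [eventually_gt_atTop 1] with x hx using (hφ.support x hx).symm

lemma IsWeight.mellinConvergent {φ : ℝ → ℂ} {σ₀ : ℝ} (hφ : IsWeight φ σ₀) {s : ℂ}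
    (hs : σ₀ < s.re) : MellinConvergent φ s :=
  mellinConvergent_of_isBigO_rpow hφ.locallyIntegrableOn (hφ.isBigO_atTop (s.re + 1))
    (by linarith) hφ.at_zero hs

lemma IsWeight.differentiableAt_mellin {φ : ℝ → ℂ} {σ₀ : ℝ} (hφ : IsWeight φ σ₀) {s : ℂ}
    (hs : σ₀ < s.re) : DifferentiableAt ℂ (mellin φ) s :=
  mellin_differentiableAt_of_isBigO_rpow hφ.locallyIntegrableOn (hφ.isBigO_atTop (s.re + 1))
    (by linarith) hφ.at_zero hs

lemma isOpen_halfPlane (r : ℝ) : IsOpen (halfPlane r) := isOpen_lt continuous_const continuous_re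

lemma integral_comp_natCast_div (f : ℝ → ℂ) (s : ℂ) {n : ℕ} (hn : n ≠ 0) :
    ∫ u in Ioi (0 : ℝ), (u : ℂ) ^ (-s - 1) * f (n / u) = (n : ℂ) ^ (-s) * mellin f s := by
  have hn' : (0 : ℝ) < n := by exact_mod_cast Nat.pos_of_ne_zero hn
  have h1 := mellin_comp_inv (fun t => f (n * t)) (-s)
  rw [neg_neg, mellin_comp_mul_left f s hn', ofReal_natCast, smul_eq_mul] at h1
  rw [← h1, mellin]
  simp only [div_eq_mul_inv, smul_eq_mul]

lemma integrableOn_comp_natCast_div {f : ℝ → ℂ} {s : ℂ} (hf : MellinConvergent f s) {n : ℕ}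
    (hn : n ≠ 0) : IntegrableOn (fun u : ℝ => (u : ℂ) ^ (-s - 1) * f (n / u)) (Ioi 0) := by
  have hn' : (0 : ℝ) < n := by exact_mod_cast Nat.pos_of_ne_zero hn
  have h1 := (MellinConvergent.comp_rpow (f := fun t => f (n * t)) (s := -s) (a := -1)
    (by norm_num)).2
    (by simpa using (MellinConvergent.comp_mul_left hn').2 hf)
  simpa only [MellinConvergent, Real.rpow_neg_one, div_eq_mul_inv, smul_eq_mul] using h1

/-- The sum `∑_{1 ≤ n < u} a_n φ(n/u)`. -/
def weightedSum (a : ℕ → ℂ) (φ : ℝ → ℂ) (u : ℝ) : ℂ :=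
  ∑ n ∈ Finset.Ico 1 ⌈u⌉₊, a n * φ (n / u)

lemma weightedSum_of_le_one (a : ℕ → ℂ) (φ : ℝ → ℂ) {u : ℝ} (hu : u ≤ 1) :
    weightedSum a φ u = 0 := by
  rw [weightedSum, Finset.Ico_eq_empty, Finset.sum_empty]
  simpa using hu

/-- Away from the integers, where a value of `φ` at `1` would enter, `weightedSum` is the sum over
all `n ≥ 1`. -/
lemma ae_hasSum_weightedSum {φ : ℝ → ℂ} {σ₀ : ℝ} (hφ : IsWeight φ σ₀) (a : ℕ → ℂ) :
    ∀ᵐ u ∂volume.restrict (Ioi (0 : ℝ)),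
      HasSum (fun n : ℕ => if n = 0 then 0 else a n * φ (n / u)) (weightedSum a φ u) := by
  have hnull : ∀ᵐ u : ℝ, u ∉ range ((↑) : ℕ → ℝ) :=
    (countable_range _).ae_notMem _
  filter_upwards [ae_restrict_mem measurableSet_Ioi, ae_restrict_of_ae hnull] with u hu hun
  have hu : 0 < u := hu
  have h : HasSum (fun n : ℕ => if n = 0 then 0 else a n * φ (n / u))
      (∑ n ∈ Finset.Ico 1 ⌈u⌉₊, if n = 0 then 0 else a n * φ (n / u)) :=
    hasSum_sum_of_ne_finset_zero ?_
  · convert h using 1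
    refine Finset.sum_congr rfl fun n hn => ?_
    rw [if_neg (by have := (Finset.mem_Ico.1 hn).1; omega)]
  · intro n hn
    by_cases h0 : n = 0
    · simp [h0]
    · rw [if_neg h0, hφ.support, mul_zero]
      rw [one_lt_div hu]
      have h1 : ⌈u⌉₊ ≤ n := by
        by_contra hlt
        exact hn (Finset.mem_Ico.2 ⟨by omega, by omega⟩)
      exact lt_of_le_of_ne (Nat.ceil_le.1 h1) fun h => hun ⟨n, h.symm⟩

/-- The map `t ↦ c / t` of `(0, ∞)` is an involution which preserves null sets. -/
lemma quasiMeasurePreserving_const_div {c : ℝ} (hc : 0 < c) :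
    Measure.QuasiMeasurePreserving (fun t : ℝ => c / t) (volume.restrict (Ioi 0))
      (volume.restrict (Ioi 0)) := by
  have hmeas : Measurable fun t : ℝ => c / t := measurable_const.div measurable_id
  refine ⟨hmeas, Measure.AbsolutelyContinuous.mk fun s hs h0 => ?_⟩
  rw [Measure.restrict_apply hs] at h0
  rw [Measure.map_apply hmeas hs, Measure.restrict_apply (hmeas hs)]
  have hd : DifferentiableOn ℝ (fun t : ℝ => c / t) (s ∩ Ioi 0) := fun t ht =>
    ((differentiableAt_const c).div differentiableAt_id
      (ne_of_gt (mem_Ioi.1 ht.2))).differentiableWithinAt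
  refine measure_mono_null (fun t ht => ?_)
    (addHaar_image_eq_zero_of_differentiableOn_of_addHaar_eq_zero volume hd h0)
  have ht0 : 0 < t := ht.2
  exact ⟨c / t, ⟨ht.1, div_pos hc ht0⟩, by field_simp⟩

lemma aestronglyMeasurable_weightedSum {φ : ℝ → ℂ} {σ₀ : ℝ} (hφ : IsWeight φ σ₀) (a : ℕ → ℂ) :
    AEStronglyMeasurable (weightedSum a φ) (volume.restrict (Ioi 0)) := by
  refine aestronglyMeasurable_of_tendsto_ae atTop
    (f := fun N u => ∑ n ∈ Finset.range N, if n = 0 then 0 else a n * φ (n / u)) (fun N => ?_) ?_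
  · refine Finset.aestronglyMeasurable_fun_sum _ fun n _ => ?_
    split_ifs with hn
    · exact aestronglyMeasurable_const
    · exact (hφ.aemeasurable.aestronglyMeasurable.comp_quasiMeasurePreserving
        (quasiMeasurePreserving_const_div (c := n)
          (by exact_mod_cast Nat.pos_of_ne_zero hn))).const_mul _
  · filter_upwards [ae_hasSum_weightedSum hφ a] with u hu using hu.tendsto_sum_nat

lemma IsDirichletContinuation.lseriesSummable {a : ℕ → ℂ} {L : ℂ → ℂ} {σ₀ : ℝ} {m : ℕ}
    (hL : IsDirichletContinuation a L σ₀ m) {s : ℂ} (hs : 1 < s.re) : LSeriesSummable a s := by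
  refine LSeriesSummable_of_isBigO_rpow (x := (1 + s.re) / 2) (by linarith) ?_
  exact hL.coeff_bound _ (by linarith)

/-- In the half-plane of absolute convergence the Mellin transform of `u ↦ ∑_{n<u} a_n φ(n/u)` is
the product of `L` and the Mellin transform of `φ`. -/
lemma integral_weightedSum {a : ℕ → ℂ} {L : ℂ → ℂ} {φ : ℝ → ℂ} {σ₀ : ℝ} {m : ℕ}
    (hL : IsDirichletContinuation a L σ₀ m) (hφ : IsWeight φ σ₀) {s : ℂ} (hs : 1 < s.re) :
    ∫ u in Ioi (1 : ℝ), (u : ℂ) ^ (-s - 1) * weightedSum a φ u = L s * mellin φ s := by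
  have hσ : σ₀ < s.re := hL.abscissa_lt_one.trans hs
  -- There is no `n ≥ 1` with `n < u` if `u ≤ 1`, so the integral may start at `0`.
  have hext : ∫ u in Ioi (1 : ℝ), (u : ℂ) ^ (-s - 1) * weightedSum a φ u
      = ∫ u in Ioi (0 : ℝ), (u : ℂ) ^ (-s - 1) * weightedSum a φ u := by
    refine (setIntegral_eq_of_subset_of_forall_sdiff_eq_zero measurableSet_Ioi
      (Ioi_subset_Ioi zero_le_one) fun u hu => ?_).symm
    rw [weightedSum_of_le_one a φ (not_lt.1 hu.2), mul_zero]
  -- The coefficient `a 0` does not enter the Dirichlet series.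
  set F : ℕ → ℝ → ℂ := fun n u =>
    (if n = 0 then 0 else a n) * ((u : ℂ) ^ (-s - 1) * φ (n / u)) with hF
  have hint : ∀ n, IntegrableOn (F n) (Ioi 0) := by
    intro n
    by_cases hn : n = 0
    · simp [hF, hn]
    · exact (integrableOn_comp_natCast_div (hφ.mellinConvergent hσ) hn).const_mul _
  have hval : ∀ n, ∫ u in Ioi (0 : ℝ), F n u = LSeries.term a s n * mellin φ s := by
    intro n
    rw [hF, integral_const_mul, LSeries.term_def]
    by_cases hn : n = 0
    · simp [hn]
    · rw [integral_comp_natCast_div _ _ hn, if_neg hn, if_neg hn, cpow_neg]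
      ring
  have hnorm : ∀ n, ∫ u in Ioi (0 : ℝ), ‖F n u‖
      = ‖LSeries.term a s n‖ * ∫ t in Ioi (0 : ℝ), t ^ (s.re - 1) * ‖φ t‖ := by
    intro n
    by_cases hn : n = 0
    · simp [hF, hn]
    have hn' : 0 < n := Nat.pos_of_ne_zero hn
    have key := integral_comp_natCast_div (fun t => ((‖φ t‖ : ℝ) : ℂ)) (s.re : ℂ) hn
    have h1 : ∫ u in Ioi (0 : ℝ), (u : ℂ) ^ (-(s.re : ℂ) - 1) * ((‖φ (n / u)‖ : ℝ) : ℂ)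
        = ((∫ u in Ioi (0 : ℝ), ‖(u : ℂ) ^ (-s - 1) * φ (n / u)‖ : ℝ) : ℂ) := by
      rw [← integral_complex_ofReal]
      refine setIntegral_congr_fun measurableSet_Ioi fun u hu => ?_
      have hu : 0 < u := hu
      rw [norm_mul, norm_cpow_eq_rpow_re_of_pos hu, ofReal_mul, ofReal_cpow hu.le]
      simp
    have h2 : mellin (fun t => ((‖φ t‖ : ℝ) : ℂ)) (s.re : ℂ)
        = ((∫ t in Ioi (0 : ℝ), t ^ (s.re - 1) * ‖φ t‖ : ℝ) : ℂ) := by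
      rw [← integral_complex_ofReal, mellin]
      refine setIntegral_congr_fun measurableSet_Ioi fun u hu => ?_
      have hu : 0 < u := hu
      rw [ofReal_mul, ofReal_cpow hu.le]
      simp
    have h3 : (n : ℂ) ^ (-(s.re : ℂ)) = (((n : ℝ) ^ s.re)⁻¹ : ℝ) := by
      rw [cpow_neg, ofReal_inv, ofReal_cpow (Nat.cast_nonneg n), ofReal_natCast]
    rw [h1, h2, h3, ← ofReal_mul, ofReal_inj] at key
    simp only [hF, norm_mul, if_neg hn] at key ⊢
    rw [integral_const_mul, key, LSeries.term_of_ne_zero hn, norm_div,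
      norm_natCast_cpow_of_pos hn']
    ring
  have hsum := hasSum_integral_of_summable_integral_norm hint (by
    simp only [hnorm]
    exact (hL.lseriesSummable hs).norm.mul_right _)
  simp only [hval] at hsum
  have hL' : L s = ∑' n, LSeries.term a s n := hL.eq_series s hs
  rw [hext, hL', ← tsum_mul_right, hsum.tsum_eq]
  refine integral_congr_ae ?_
  filter_upwards [ae_hasSum_weightedSum hφ a] with u hu
  rw [← hu.tsum_eq, ← tsum_mul_left]
  refine tsum_congr fun n => ?_
  simp only [hF]
  split_ifs <;> ring

/-- A Mellin integral over `(1, ∞)` which converges absolutely in a half-plane is holomorphic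
there. -/
lemma differentiableAt_integral_cpow_mul {f : ℝ → ℂ} {r : ℝ}
    (hf : ∀ s : ℂ, r < s.re → IntegrableOn (fun u : ℝ => (u : ℂ) ^ (-s - 1) * f u) (Ioi 1))
    (hfm : AEStronglyMeasurable f (volume.restrict (Ioi 1)))
    {s : ℂ} (hs : r < s.re) :
    DifferentiableAt ℂ (fun s : ℂ => ∫ u in Ioi (1 : ℝ), (u : ℂ) ^ (-s - 1) * f u) s := by
  obtain ⟨ε, hε, hε'⟩ : ∃ ε : ℝ, 0 < ε ∧ r < s.re - 2 * ε :=
    ⟨(s.re - r) / 3, by linarith, by linarith⟩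
  -- The factor `log u` of the derivative costs `u^ε`, the variation of `z` in the ball another one.
  have hcont : ∀ z : ℂ, AEStronglyMeasurable (fun u : ℝ => (u : ℂ) ^ z)
      (volume.restrict (Ioi 1)) := fun z =>
    ContinuousOn.aestronglyMeasurable (fun u (hu : 1 < u) =>
      (continuousAt_ofReal_cpow_const _ _ (Or.inr (by linarith))).continuousWithinAt)
      measurableSet_Ioi
  have hlog : AEStronglyMeasurable (fun u : ℝ => -(Real.log u : ℂ)) (volume.restrict (Ioi 1)) :=
    (Complex.measurable_ofReal.comp Real.measurable_log).neg.aestronglyMeasurable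
  refine (hasDerivAt_integral_of_dominated_loc_of_deriv_le (μ := volume.restrict (Ioi (1 : ℝ)))
    (F := fun (z : ℂ) (u : ℝ) => (u : ℂ) ^ (-z - 1) * f u)
    (F' := fun (z : ℂ) (u : ℝ) => ((u : ℂ) ^ (-z - 1) * -(Real.log u : ℂ)) * f u)
    (bound := fun u => ε⁻¹ * ‖(u : ℂ) ^ (-(s - 2 * ε : ℂ) - 1) * f u‖)
    (Metric.ball_mem_nhds s hε) (Eventually.of_forall fun z => (hcont _).mul hfm)
    (hf s hs) (((hcont _).mul hlog).mul hfm) ?_ ?_ ?_).2.differentiableAt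
  · filter_upwards [ae_restrict_mem measurableSet_Ioi] with u hu z hz
    have hu : 1 < u := hu
    have hu0 : 0 < u := one_pos.trans hu
    rw [norm_mul, norm_mul, norm_mul, ← mul_assoc, norm_cpow_eq_rpow_re_of_pos hu0,
      norm_cpow_eq_rpow_re_of_pos hu0, norm_neg, norm_real, Real.norm_eq_abs,
      abs_of_nonneg (Real.log_nonneg hu.le)]
    refine mul_le_mul_of_nonneg_right ?_ (norm_nonneg _)
    have h1 := Real.log_le_rpow_div hu0.le hε
    have h2 : s.re - ε ≤ z.re := by
      have := (abs_re_le_norm (z - s)).trans (mem_ball_iff_norm.1 hz).le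
      rw [sub_re, abs_le] at this
      linarith
    calc u ^ (-z - 1).re * Real.log u
        ≤ u ^ (-(s.re - ε) - 1) * (u ^ ε / ε) := by
          refine mul_le_mul (Real.rpow_le_rpow_of_exponent_le hu.le ?_) h1
            (Real.log_nonneg hu.le) (by positivity)
          simp; linarith
      _ = ε⁻¹ * u ^ (-(s - 2 * ε : ℂ) - 1).re := by
          rw [← mul_div_assoc, ← Real.rpow_add hu0, div_eq_inv_mul]
          congr 2
          simp
          ring
  · exact (hf _ (by simpa using hε')).norm.const_mul _
  · filter_upwards [ae_restrict_mem measurableSet_Ioi] with u hu z _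
    have hu0 : (0 : ℝ) < u := one_pos.trans hu
    have hu' : (u : ℂ) ≠ 0 := ofReal_ne_zero.2 hu0.ne'
    have h := ((hasDerivAt_id z).neg.sub_const 1).const_cpow (c := (u : ℂ)) (Or.inl hu')
    convert! h.mul_const (f u) using 1
    rw [ofReal_log hu0.le]
    simp

lemma differentiableAt_laplace (p : Polynomial ℂ) {s : ℂ} (hs : s ≠ 0) :
    DifferentiableAt ℂ (fun s => laplace s p) s := by
  induction p using Polynomial.induction_on' with
  | add p q hp hq => simpa only [map_add] using! hp.add hq
  | monomial n c =>
    simp only [← Polynomial.C_mul_X_pow_eq_monomial, laplace_C_mul_X_pow]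
    have hs' : s ^ (n + 1) ≠ 0 := pow_ne_zero _ hs
    fun_prop (disch := assumption)

/-- The punctured half-plane is a chain of four overlapping convex sets. -/
lemma isPreconnected_halfPlane_diff_one {r : ℝ} (hr : r < 1) :
    IsPreconnected (halfPlane r \ {1}) := by
  have h1 : IsPreconnected {s : ℂ | 1 < s.re} := (convex_halfSpace_re_gt 1).isPreconnected
  have h2 : IsPreconnected ({s : ℂ | r < s.re} ∩ {s : ℂ | 0 < s.im}) :=
    ((convex_halfSpace_re_gt r).inter (convex_halfSpace_im_gt 0)).isPreconnected
  have h3 : IsPreconnected ({s : ℂ | r < s.re} ∩ {s : ℂ | s.im < 0}) :=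
    ((convex_halfSpace_re_gt r).inter (convex_halfSpace_im_lt 0)).isPreconnected
  have h4 : IsPreconnected ({s : ℂ | r < s.re} ∩ {s : ℂ | s.re < 1}) :=
    ((convex_halfSpace_re_gt r).inter (convex_halfSpace_re_lt 1)).isPreconnected
  have h12 := h1.union (2 + I) (by simp) (by simp; linarith) h2
  have h34 := h4.union (⟨(r + 1) / 2, -1⟩ : ℂ) (by simp; constructor <;> linarith)
    (by simp; linarith) h3
  have h := h12.union (⟨(r + 1) / 2, 1⟩ : ℂ) (Or.inr (by simp; linarith)) (s := _) (t := _)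
    (?_ : (⟨(r + 1) / 2, 1⟩ : ℂ) ∈ ({s : ℂ | r < s.re} ∩ {s : ℂ | s.re < 1}) ∪
      ({s : ℂ | r < s.re} ∩ {s : ℂ | s.im < 0})) h34
  · convert h using 1
    ext s
    simp only [halfPlane, Set.mem_sdiff, mem_ofPred_eq, mem_singleton_iff, mem_union, mem_inter_iff]
    have hs : s = 1 ↔ s.re = 1 ∧ s.im = 0 := by rw [Complex.ext_iff]; simp
    rw [hs]
    rcases lt_trichotomy s.im 0 with h | h | h <;> rcases lt_trichotomy s.re 1 with h' | h' | h' <;>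
      constructor <;> intro hh <;> grind
  · left; simp; constructor <;> linarith

/-! ### The function `ψ` -/

/-- `ψ(u) = u P(log u) - ∑_{n<u} a_n φ(n/u)` with a polynomial `P` of degree less than the order of
the pole. -/
lemma exists_psi_eq {a : ℕ → ℂ} {L : ℂ → ℂ} {φ : ℝ → ℂ} {σ₀ : ℝ} {m : ℕ}
    (hL : IsDirichletContinuation a L σ₀ m) (hφ : IsWeight φ σ₀) :
    ∃ P ∈ Polynomial.degreeLT ℂ m, ∀ u : ℝ, 0 < u →
      psi a L φ u = u * P.eval (Real.log u : ℂ) - weightedSum a φ u := by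
  have hm := hL.one_le_order
  have hmer : MeromorphicAt L 1 := by
    refine meromorphicAt_of_meromorphicOrderAt_ne_zero ?_
    rw [hL.pole]
    norm_cast
    omega
  have hord : meromorphicOrderAt L 1 = ((-(m : ℤ) : ℤ) : WithTop ℤ) := by
    rw [hL.pole]; norm_cast
  obtain ⟨g, hg, -, hLg⟩ := (meromorphicOrderAt_eq_int_iff hmer).1 hord
  have hmel : AnalyticAt ℂ (mellin φ) 1 := by
    rw [analyticAt_iff_eventually_differentiableAt]
    filter_upwards [(isOpen_halfPlane σ₀).mem_nhds (x := 1) (by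
      simpa [halfPlane] using hL.abscissa_lt_one)] with z hz
    exact hφ.differentiableAt_mellin hz
  obtain ⟨P, hP, hres⟩ := exists_residue_mul_cpow_eq (F := fun s => L s * mellin φ s) hm
    (hg.mul hmel) (hLg.mono fun z hz => by
      rw [hz, zpow_neg, zpow_natCast, smul_eq_mul, Pi.mul_apply]; ring)
  exact ⟨P, hP, fun u hu => by rw [psi, hres u hu, weightedSum]⟩

lemma aestronglyMeasurable_psi {a : ℕ → ℂ} {L : ℂ → ℂ} {φ : ℝ → ℂ} {σ₀ : ℝ}
    (hφ : IsWeight φ σ₀) {P : Polynomial ℂ}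
    (hP : ∀ u : ℝ, 0 < u → psi a L φ u = u * P.eval (Real.log u : ℂ) - weightedSum a φ u) :
    AEStronglyMeasurable (psi a L φ) (volume.restrict (Ioi 0)) := by
  have h := (continuousOn_cpow_mul_eval_log 1 P).aestronglyMeasurable (μ := volume)
    measurableSet_Ioi
  refine (h.sub (aestronglyMeasurable_weightedSum hφ a)).congr ?_
  filter_upwards [ae_restrict_mem measurableSet_Ioi] with u hu
  rw [hP u hu, Pi.sub_apply, cpow_one]

lemma continuousOn_psi_Ioc {a : ℕ → ℂ} {L : ℂ → ℂ} {φ : ℝ → ℂ} {P : Polynomial ℂ}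
    (hP : ∀ u : ℝ, 0 < u → psi a L φ u = u * P.eval (Real.log u : ℂ) - weightedSum a φ u) :
    ContinuousOn (psi a L φ) (Ioc 0 1) := by
  refine ((continuousOn_cpow_mul_eval_log 1 P).mono fun u hu => hu.1).congr fun u hu => ?_
  rw [hP u hu.1, weightedSum_of_le_one a φ hu.2, sub_zero]
  simp only [cpow_one]

lemma continuousOn_cpow_const_Ioi (s : ℂ) :
    ContinuousOn (fun u : ℝ => (u : ℂ) ^ s) (Ioi 0) := fun u (hu : 0 < u) =>
  (continuousAt_ofReal_cpow_const _ _ (Or.inr hu.ne')).continuousWithinAt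

/-- Square integrability against `t^{-1-2r₀}` gives absolute convergence of the Mellin integral
in `Re s > r₀`. -/
lemma integrableOn_cpow_mul_of_sq {f : ℝ → ℂ} {r₀ : ℝ}
    (hf : IntegrableOn (fun t : ℝ => ‖f t‖ ^ 2 / t ^ (1 + 2 * r₀)) (Ioi 1))
    (hfm : AEStronglyMeasurable f (volume.restrict (Ioi 1))) {s : ℂ} (hs : r₀ < s.re) :
    IntegrableOn (fun u : ℝ => (u : ℂ) ^ (-s - 1) * f u) (Ioi 1) := by
  have hpow : IntegrableOn (fun u : ℝ => u ^ (2 * r₀ - 2 * s.re - 1)) (Ioi 1) :=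
    integrableOn_Ioi_rpow_of_lt (by linarith) one_pos
  refine (hf.add hpow).mono' ((((continuousOn_cpow_const_Ioi _).mono
    (Ioi_subset_Ioi zero_le_one)).aestronglyMeasurable measurableSet_Ioi).mul hfm) ?_
  filter_upwards [ae_restrict_mem measurableSet_Ioi] with u hu
  have hu0 : (0 : ℝ) < u := one_pos.trans hu
  rw [norm_mul, norm_cpow_eq_rpow_re_of_pos hu0, Pi.add_apply]
  -- `2xy ≤ x² + y²`, where `y²` is an integrable power of `u`.
  set x := ‖f u‖ * u ^ (-(1 + 2 * r₀) / 2) with hx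
  set y := u ^ ((2 * r₀ - 2 * s.re - 1) / 2) with hy
  have h1 : ‖f u‖ ^ 2 / u ^ (1 + 2 * r₀) = x ^ 2 := by
    rw [hx, mul_pow, ← Real.rpow_mul_natCast hu0.le, div_eq_mul_inv, ← Real.rpow_neg hu0.le]
    norm_num
  have h2 : u ^ (2 * r₀ - 2 * s.re - 1) = y ^ 2 := by
    rw [hy, ← Real.rpow_mul_natCast hu0.le]
    norm_num
  have h3 : u ^ (-s - 1).re * ‖f u‖ = x * y := by
    rw [hx, hy, mul_assoc, ← Real.rpow_add hu0, mul_comm]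
    congr 2
    simp
    ring
  rw [h1, h2, h3]
  nlinarith [sq_nonneg (x - y), sq_nonneg x, sq_nonneg y]

/-- Analytic continuation of the Mellin transform of `ψ` over `(1, ∞)` to `Re s > r₀`. -/
lemma integral_cpow_mul_psi {a : ℕ → ℂ} {L : ℂ → ℂ} {φ : ℝ → ℂ} {σ₀ r₀ : ℝ} {m : ℕ}
    (hL : IsDirichletContinuation a L σ₀ m) (hφ : IsWeight φ σ₀) (hσr₀ : σ₀ < r₀) (hr₀ : r₀ < 1)
    (hψ : IntegrableOn (fun t : ℝ => ‖psi a L φ t‖ ^ 2 / t ^ (1 + 2 * r₀)) (Ioi 1))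
    {P : Polynomial ℂ}
    (hP : ∀ u : ℝ, 0 < u → psi a L φ u = u * P.eval (Real.log u : ℂ) - weightedSum a φ u)
    {s : ℂ} (hs : r₀ < s.re) (hs1 : s ≠ 1) :
    ∫ u in Ioi (1 : ℝ), (u : ℂ) ^ (-s - 1) * psi a L φ u
      = laplace (s - 1) P - L s * mellin φ s := by
  have hψm : AEStronglyMeasurable (psi a L φ) (volume.restrict (Ioi 1)) :=
    (aestronglyMeasurable_psi hφ hP).mono_set (Ioi_subset_Ioi zero_le_one)
  have hint := fun (z : ℂ) (hz : r₀ < z.re) => integrableOn_cpow_mul_of_sq hψ hψm hz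
  -- Both sides are holomorphic in the punctured half-plane and agree for `Re z > 1`.
  have hopen : IsOpen (halfPlane r₀ \ {1}) := (isOpen_halfPlane r₀).sdiff isClosed_singleton
  have hsub : ∀ z ∈ halfPlane r₀ \ {1}, z ∈ halfPlane σ₀ \ {1} := fun z hz =>
    ⟨hσr₀.trans hz.1, hz.2⟩
  have hf : AnalyticOnNhd ℂ
      (fun z : ℂ => ∫ u in Ioi (1 : ℝ), (u : ℂ) ^ (-z - 1) * psi a L φ u) (halfPlane r₀ \ {1}) :=
    DifferentiableOn.analyticOnNhd (fun z hz =>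
      (differentiableAt_integral_cpow_mul hint hψm hz.1).differentiableWithinAt) hopen
  have hg : AnalyticOnNhd ℂ (fun z : ℂ => laplace (z - 1) P - L z * mellin φ z)
      (halfPlane r₀ \ {1}) :=
    DifferentiableOn.analyticOnNhd (fun z hz => by
      have h1 : DifferentiableAt ℂ (fun z => laplace (z - 1) P) z :=
        DifferentiableAt.comp (g := fun s => laplace s P) z
          (differentiableAt_laplace P (sub_ne_zero.2 hz.2)) (differentiableAt_id.sub_const 1)
      exact (h1.sub ((hL.analytic z (hsub z hz)).differentiableAt.mul
        (hφ.differentiableAt_mellin (hsub z hz).1))).differentiableWithinAt) hopen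
  refine hf.eqOn_of_preconnected_of_eventuallyEq hg (isPreconnected_halfPlane_diff_one hr₀)
    (z₀ := 2) ⟨by simp [halfPlane]; linarith, by simp⟩ ?_ ⟨hs, hs1⟩
  filter_upwards [(isOpen_halfPlane 1).mem_nhds (x := 2) (by simp [halfPlane])] with z hz
  have hz : 1 < z.re := hz
  have h1 := integral_Ioi_cpow_mul_eval_log (s := z - 1) (by simpa using hz) P
  have hi1 := integrableOn_cpow_mul_eval_log (s := -(z - 1) - 1) (by simpa using hz) P
  rw [← h1, ← integral_weightedSum hL hφ hz, eq_sub_iff_add_eq]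
  have heq : EqOn (fun u : ℝ => (u : ℂ) ^ (-z - 1) * weightedSum a φ u)
      (fun u : ℝ => (u : ℂ) ^ (-(z - 1) - 1) * P.eval (Real.log u : ℂ)
        - (u : ℂ) ^ (-z - 1) * psi a L φ u) (Ioi 1) := by
    intro u hu
    have hu0 : (0 : ℝ) < u := one_pos.trans hu
    have hu' : (u : ℂ) ≠ 0 := ofReal_ne_zero.2 hu0.ne'
    simp only
    rw [hP u hu0, show -(z - 1) - 1 = -z - 1 + 1 by ring, cpow_add _ _ hu', cpow_one]
    ring
  rw [setIntegral_congr_fun measurableSet_Ioi heq, integral_sub hi1 (hint z (hr₀.trans hz))]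
  ring

/-- At a zero of `L` the Mellin integral of `ψ` over `(α, ∞)` only depends on the polynomial `P`. -/
lemma integral_Ioi_psi_of_zero {a : ℕ → ℂ} {L : ℂ → ℂ} {φ : ℝ → ℂ} {σ₀ r₀ : ℝ} {m : ℕ}
    (hL : IsDirichletContinuation a L σ₀ m) (hφ : IsWeight φ σ₀) (hσr₀ : σ₀ < r₀) (hr₀ : r₀ < 1)
    (hψ : IntegrableOn (fun t : ℝ => ‖psi a L φ t‖ ^ 2 / t ^ (1 + 2 * r₀)) (Ioi 1))
    {P : Polynomial ℂ}
    (hP : ∀ u : ℝ, 0 < u → psi a L φ u = u * P.eval (Real.log u : ℂ) - weightedSum a φ u)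
    {s : ℂ} (hs : r₀ < s.re) (hs1 : s ≠ 1) (hzero : L s = 0) {α : ℝ} (hα : α ∈ Ioc (0 : ℝ) 1) :
    ∫ u in Ioi α, (u : ℂ) ^ (-s - 1) * psi a L φ u
      = (α : ℂ) ^ (1 - s) * laplace (s - 1) (Polynomial.taylor (Real.log α : ℂ) P) := by
  have hψm : AEStronglyMeasurable (psi a L φ) (volume.restrict (Ioi 0)) :=
    aestronglyMeasurable_psi hφ hP
  have hs0 : s - 1 ≠ 0 := sub_ne_zero.2 hs1
  have hcont : ContinuousOn (fun u : ℝ => (u : ℂ) ^ (-s - 1) * psi a L φ u) (Icc α 1) := by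
    have hsub : Icc α 1 ⊆ Ioc 0 1 := fun u hu => ⟨hα.1.trans_le hu.1, hu.2⟩
    exact ((continuousOn_cpow_const_Ioi _).mono fun u hu => (hsub hu).1).mul
      ((continuousOn_psi_Ioc hP).mono hsub)
  have hi1 : IntegrableOn (fun u : ℝ => (u : ℂ) ^ (-s - 1) * psi a L φ u) (Ioc α 1) :=
    (hcont.integrableOn_Icc).mono_set Ioc_subset_Icc_self
  have hi2 := integrableOn_cpow_mul_of_sq hψ
    (hψm.mono_set (Ioi_subset_Ioi zero_le_one)) hs
  rw [← Ioc_union_Ioi_eq_Ioi hα.2, setIntegral_union Ioc_disjoint_Ioi_same measurableSet_Ioi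
    hi1 hi2, integral_cpow_mul_psi hL hφ hσr₀ hr₀ hψ hP hs hs1, hzero, zero_mul, sub_zero]
  obtain ⟨R, -, rfl⟩ := exists_smul_sub_derivative hs0 (m := P.natDegree + 1) (p := P)
    (Polynomial.mem_degreeLT.2
      (Polynomial.degree_le_natDegree.trans_lt (by exact_mod_cast Nat.lt_succ_self _)))
  have heq : ∫ u in Ioc α 1, (u : ℂ) ^ (-s - 1) * psi a L φ u
      = (α : ℂ) ^ (1 - s) * R.eval (Real.log α : ℂ) - R.eval 0 := by
    rw [show (1 - s : ℂ) = -(s - 1) by ring, ← integral_Ioc_cpow_mul_eval_log (s - 1) R hα]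
    refine setIntegral_congr_fun measurableSet_Ioc fun u hu => ?_
    have hu0 : 0 < u := hα.1.trans hu.1
    have hu' : (u : ℂ) ≠ 0 := ofReal_ne_zero.2 hu0.ne'
    rw [hP u hu0, weightedSum_of_le_one a φ hu.2, show -(s - 1) - 1 = -s - 1 + 1 by ring,
      cpow_add _ _ hu', cpow_one]
    ring
  have htaylor : Polynomial.taylor (Real.log α : ℂ) (Polynomial.C (s - 1) * R - R.derivative)
      = Polynomial.C (s - 1) * Polynomial.taylor (Real.log α : ℂ) R
        - (Polynomial.taylor (Real.log α : ℂ) R).derivative := by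
    simp only [Polynomial.taylor_apply, Polynomial.sub_comp, Polynomial.mul_comp,
      Polynomial.C_comp, Polynomial.derivative_comp]
    simp
  rw [heq, htaylor, laplace_smul_sub_derivative hs0, laplace_smul_sub_derivative hs0,
    Polynomial.taylor_apply, Polynomial.eval_comp]
  simp

section Substitution

variable {α : ℝ}

lemma image_const_div_Ioi (hα : 0 < α) : (fun u : ℝ => α / u) '' Ioi α = Ioo 0 1 := by
  ext t
  simp only [mem_image, mem_Ioi, mem_Ioo]
  constructor
  · rintro ⟨u, hu, rfl⟩
    exact ⟨div_pos hα (hα.trans hu), (div_lt_one (hα.trans hu)).2 hu⟩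
  · rintro ⟨h0, h1⟩
    exact ⟨α / t, (lt_div_iff₀ h0).2 (by nlinarith), by field_simp⟩

lemma hasDerivWithinAt_const_div (hα : 0 < α) :
    ∀ u ∈ Ioi α, HasDerivWithinAt (fun u : ℝ => α / u) (-(α / u ^ 2)) (Ioi α) u := by
  intro u hu
  have hu0 : u ≠ 0 := (hα.trans hu).ne'
  convert! ((hasDerivAt_inv hu0).const_mul α).hasDerivWithinAt using 1
  rw [mul_neg, div_eq_mul_inv]

lemma injOn_const_div (hα : 0 < α) : InjOn (fun u : ℝ => α / u) (Ioi α) := by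
  intro u _ v _ h
  simpa [div_eq_mul_inv, hα.ne'] using h

/-- The substitution `t = α / u` from `(α, ∞)` to `(0, 1)`. -/
lemma integrableOn_Ioo_iff_comp_const_div (hα : 0 < α) (g : ℝ → ℝ) :
    IntegrableOn g (Ioo 0 1) ↔ IntegrableOn (fun u => α / u ^ 2 * g (α / u)) (Ioi α) := by
  rw [← image_const_div_Ioi hα, integrableOn_image_iff_integrableOn_abs_deriv_smul
    measurableSet_Ioi (hasDerivWithinAt_const_div hα) (injOn_const_div hα)]
  simp [abs_div, abs_of_pos hα]

lemma integral_Ioo_comp_const_div (hα : 0 < α) (g : ℝ → ℂ) :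
    ∫ t in Ioo (0 : ℝ) 1, g t = ∫ u in Ioi α, ((α / u ^ 2 : ℝ) : ℂ) * g (α / u) := by
  rw [← image_const_div_Ioi hα, integral_image_eq_integral_abs_deriv_smul
    measurableSet_Ioi (hasDerivWithinAt_const_div hα) (injOn_const_div hα)]
  simp [abs_div, abs_of_pos hα]

end Substitution

/-! ### The weighted `L²` space -/

section WeightedL2

variable {σ₀ : ℝ}

lemma measurable_weight (σ₀ : ℝ) :
    Measurable fun t : ℝ => ENNReal.ofReal (1 / t ^ (1 - 2 * σ₀)) := by
  fun_prop

lemma toReal_weight (σ₀ : ℝ) {t : ℝ} (ht : 0 < t) :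
    (ENNReal.ofReal (1 / t ^ (1 - 2 * σ₀))).toReal = t ^ (2 * σ₀ - 1) := by
  rw [ENNReal.toReal_ofReal (by positivity), one_div, ← Real.rpow_neg ht.le]
  ring_nf

lemma integrable_weightMeasure_iff {E : Type*} [NormedAddCommGroup E] [NormedSpace ℝ E]
    (g : ℝ → E) : Integrable g (weightMeasure σ₀) ↔
      IntegrableOn (fun t => t ^ (2 * σ₀ - 1) • g t) (Ioi 0) := by
  rw [weightMeasure, integrable_withDensity_iff_integrable_smul' (measurable_weight σ₀)
    (Eventually.of_forall fun _ => ENNReal.ofReal_lt_top)]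
  refine integrable_congr ?_
  filter_upwards [ae_restrict_mem measurableSet_Ioi] with t ht
  rw [toReal_weight σ₀ ht]

lemma integral_weightMeasure (g : ℝ → ℂ) :
    ∫ t, g t ∂weightMeasure σ₀ = ∫ t in Ioi 0, ((t ^ (2 * σ₀ - 1) : ℝ) : ℂ) * g t := by
  rw [weightMeasure, integral_withDensity_eq_integral_toReal_smul (measurable_weight σ₀)
    (Eventually.of_forall fun _ => ENNReal.ofReal_lt_top)]
  refine setIntegral_congr_fun measurableSet_Ioi fun t ht => ?_
  simp only [toReal_weight σ₀ ht, real_smul]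

lemma integrableOn_Ioi_zero_iff {E : Type*} [NormedAddCommGroup E] (g : ℝ → E) :
    IntegrableOn g (Ioi 0) ↔ IntegrableOn g (Ioo 0 1) ∧ IntegrableOn g (Ioi 1) := by
  rw [← Ioc_union_Ioi_eq_Ioi zero_le_one, integrableOn_union, integrableOn_Ioc_iff_integrableOn_Ioo]

lemma memLp_weightMeasure {f : ℝ → ℂ} (hm : AEStronglyMeasurable f (volume.restrict (Ioi 0)))
    (h1 : IntegrableOn (fun t => t ^ (2 * σ₀ - 1) * ‖f t‖ ^ 2) (Ioo 0 1))
    (h2 : IntegrableOn (fun t => t ^ (2 * σ₀ - 1) * ‖f t‖ ^ 2) (Ioi 1)) :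
    MemLp f 2 (weightMeasure σ₀) := by
  have hm' : AEStronglyMeasurable f (weightMeasure σ₀) :=
    hm.mono_ac (withDensity_absolutelyContinuous _ _)
  rw [memLp_two_iff_integrable_sq_norm hm',
    integrable_weightMeasure_iff, integrableOn_Ioi_zero_iff]
  exact ⟨h1, h2⟩

lemma inner_toL2 {f g : ℝ → ℂ} (hf : MemLp f 2 (weightMeasure σ₀))
    (hg : MemLp g 2 (weightMeasure σ₀)) :
    inner ℂ (toL2 σ₀ f) (toL2 σ₀ g)
      = (∫ t in Ioo (0 : ℝ) 1, ((t ^ (2 * σ₀ - 1) : ℝ) : ℂ) * (conj (f t) * g t))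
        + ∫ t in Ioi (1 : ℝ), ((t ^ (2 * σ₀ - 1) : ℝ) : ℂ) * (conj (f t) * g t) := by
  have hae : (fun t => inner ℂ (hf.toLp f t) (hg.toLp g t))
      =ᵐ[weightMeasure σ₀] fun t => conj (f t) * g t := by
    filter_upwards [hf.coeFn_toLp, hg.coeFn_toLp] with t h1 h2
    rw [h1, h2, RCLike.inner_apply, mul_comm]
  have hint : Integrable (fun t => conj (f t) * g t) (weightMeasure σ₀) :=
    (L2.integrable_inner (𝕜 := ℂ) (hf.toLp f) (hg.toLp g)).congr hae
  have hint' := (integrableOn_Ioi_zero_iff _).1 ((integrable_weightMeasure_iff _).1 hint)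
  simp only [real_smul] at hint'
  rw [toL2, dif_pos hf, toL2, dif_pos hg, L2.inner_def, integral_congr_ae hae,
    integral_weightMeasure, ← Ioc_union_Ioi_eq_Ioi zero_le_one,
    setIntegral_union Ioc_disjoint_Ioi_same measurableSet_Ioi
      ((integrableOn_Ioc_iff_integrableOn_Ioo enorm_ne_top).2 hint'.1) hint'.2, integral_Ioc_eq_integral_Ioo]

/-- The tail on `(1, ∞)` common to `u_{r,λ}` and the dilates of `ψ` is square integrable as `r < 1`. -/
lemma integrableOn_sq_norm_of_tail {f : ℝ → ℂ} {r : ℝ} (hr : r < 1) {p : Polynomial ℂ}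
    (hf : ∀ t : ℝ, 1 < t → f t = ((t ^ (r - σ₀ - 1) : ℝ) : ℂ) * p.eval (Real.log t : ℂ)) :
    IntegrableOn (fun t => t ^ (2 * σ₀ - 1) * ‖f t‖ ^ 2) (Ioi 1) := by
  -- `|p|² = |p · p|`, and `2(r - σ₀ - 1) + (2σ₀ - 1) = 2r - 3 < -1`.
  have h := (integrableOn_cpow_mul_eval_log (s := ((2 * r - 3 : ℝ) : ℂ))
    (by rw [ofReal_re]; linarith) (p * p)).norm
  refine (integrableOn_congr_fun (fun t ht => ?_) measurableSet_Ioi).1 h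
  have ht0 : (0 : ℝ) < t := one_pos.trans ht
  rw [hf t ht, norm_mul, norm_mul, norm_cpow_eq_rpow_re_of_pos ht0, Polynomial.eval_mul, norm_mul,
    norm_real, Real.norm_eq_abs, abs_of_pos (by positivity), ofReal_re, mul_pow,
    ← Real.rpow_mul_natCast ht0.le, ← mul_assoc (t ^ (2 * σ₀ - 1)), ← Real.rpow_add ht0]
  rw [sq]
  congr 2
  push_cast
  ring

lemma integral_tail {f g : ℝ → ℂ} {r : ℝ} (hr : r < 1) {p q : Polynomial ℂ}
    (hf : ∀ t : ℝ, 1 < t → conj (f t) = ((t ^ (r - σ₀ - 1) : ℝ) : ℂ) * q.eval (Real.log t : ℂ))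
    (hg : ∀ t : ℝ, 1 < t → g t = ((t ^ (r - σ₀ - 1) : ℝ) : ℂ) * p.eval (Real.log t : ℂ)) :
    ∫ t in Ioi (1 : ℝ), ((t ^ (2 * σ₀ - 1) : ℝ) : ℂ) * (conj (f t) * g t)
      = laplace (constA r) (p * q) := by
  have hA : constA r = ((2 - 2 * r : ℝ) : ℂ) := by simp [constA]
  rw [← integral_Ioi_cpow_mul_eval_log (by rw [hA, ofReal_re]; linarith)]
  refine setIntegral_congr_fun measurableSet_Ioi fun t ht => ?_
  have ht0 : (0 : ℝ) < t := one_pos.trans ht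
  have ht' : (t : ℂ) ≠ 0 := ofReal_ne_zero.2 ht0.ne'
  rw [hf t ht, hg t ht, Polynomial.eval_mul,
    show -constA r - 1 = ((2 * σ₀ - 1 : ℝ) : ℂ) + ((r - σ₀ - 1 : ℝ) : ℂ) + ((r - σ₀ - 1 : ℝ) : ℂ) by
      rw [hA]; push_cast; ring,
    cpow_add _ _ ht', cpow_add _ _ ht', ofReal_cpow ht0.le, ofReal_cpow ht0.le]
  ring

lemma toL2_add {f g : ℝ → ℂ} (hf : MemLp f 2 (weightMeasure σ₀))
    (hg : MemLp g 2 (weightMeasure σ₀)) : toL2 σ₀ (f + g) = toL2 σ₀ f + toL2 σ₀ g := by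
  rw [toL2, dif_pos (hf.add hg), toL2, dif_pos hf, toL2, dif_pos hg, MemLp.toLp_add]

lemma toL2_const_smul {f : ℝ → ℂ} (hf : MemLp f 2 (weightMeasure σ₀)) (c : ℂ) :
    toL2 σ₀ (c • f) = c • toL2 σ₀ f := by
  rw [toL2, dif_pos (hf.const_smul c), toL2, dif_pos hf, MemLp.toLp_const_smul]

lemma inner_toL2_sum_eq_zero {ι : Type*} (s : Finset ι) (c : ι → ℂ) (g : ι → ℝ → ℂ)
    (v : WeightedL2 σ₀) (hg : ∀ i, MemLp (g i) 2 (weightMeasure σ₀))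
    (hv : ∀ i, inner ℂ v (toL2 σ₀ (g i)) = 0) :
    inner ℂ v (toL2 σ₀ (∑ i ∈ s, c i • g i)) = 0 := by
  classical
  induction s using Finset.induction_on with
  | empty =>
    have h0 : MemLp (0 : ℝ → ℂ) 2 (weightMeasure σ₀) := MemLp.zero
    rw [Finset.sum_empty, toL2, dif_pos h0, MemLp.toLp_zero, inner_zero_right]
  | insert i s hi ih =>
    rw [Finset.sum_insert hi, toL2_add ((hg i).const_smul _)
      (memLp_finsetSum' s fun j _ => (hg j).const_smul _), toL2_const_smul (hg i), inner_add_right,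
      inner_smul_right, hv, ih, mul_zero, add_zero]

end WeightedL2

/-! ### The functions `u_{r,λ}` -/

section Kernel

variable {m : ℕ} {σ₀ r : ℝ} {lam μ : ℂ}

lemma Q_eq_eval_qPoly (m : ℕ) (σ₀ r : ℝ) (lam x : ℂ) :
    Q m σ₀ r lam x = (qPoly m (constA r) (constB σ₀ r lam)).eval x := by
  simp [Q, qPoly, Polynomial.eval_finsetSum]

lemma conj_constA (r : ℝ) : conj (constA r) = constA r := by simp [constA, map_ofNat]

lemma conj_constB (σ₀ r : ℝ) (lam : ℂ) : conj (constB σ₀ r lam) = r + σ₀ - 1 - lam := by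
  simp [constB]

lemma conj_Q (m : ℕ) (σ₀ r : ℝ) (lam : ℂ) (x : ℝ) :
    conj (Q m σ₀ r lam x) = (qPoly m (constA r) (r + σ₀ - 1 - lam)).eval (x : ℂ) := by
  rw [← conj_constB, ← conj_constA r]
  simp [Q, qPoly, Polynomial.eval_finsetSum, conj_constA]

lemma uFun_of_lt_one {t : ℝ} (ht : t ∈ Ioo (0 : ℝ) 1) :
    uFun m σ₀ r lam t = (1 + constA r / constB σ₀ r lam) ^ m * (t : ℂ) ^ (conj lam - 2 * σ₀) := by
  have h1 : t ∉ Ioi (1 : ℝ) := not_lt.2 ht.2.le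
  rw [uFun, indicator_of_mem ht, indicator_of_notMem h1]
  simp

lemma uFun_of_one_lt {t : ℝ} (ht : 1 < t) :
    uFun m σ₀ r lam t = ((t ^ (r - σ₀ - 1) : ℝ) : ℂ)
      * (qPoly m (constA r) (constB σ₀ r lam)).eval (Real.log t : ℂ) := by
  have h1 : t ∉ Ioo (0 : ℝ) 1 := fun h => lt_asymm ht h.2
  rw [uFun, indicator_of_mem (mem_Ioi.2 ht), indicator_of_notMem h1, Q_eq_eval_qPoly]
  simp [mul_comm]

lemma conj_cpow_ofReal {t : ℝ} (ht : 0 < t) (z : ℂ) : conj ((t : ℂ) ^ z) = (t : ℂ) ^ conj z := by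
  rw [cpow_conj _ _ (by rw [arg_ofReal_of_nonneg ht.le]; exact Real.pi_ne_zero.symm), conj_ofReal]

lemma conj_uFun_of_lt_one {t : ℝ} (ht : t ∈ Ioo (0 : ℝ) 1) :
    conj (uFun m σ₀ r lam t)
      = (1 + constA r / (r + σ₀ - 1 - lam)) ^ m * (t : ℂ) ^ (lam - 2 * σ₀) := by
  rw [uFun_of_lt_one ht, map_mul, conj_cpow_ofReal ht.1, map_pow, map_add, map_div₀, conj_constA,
    conj_constB]
  simp [map_ofNat]

lemma conj_uFun_of_one_lt {t : ℝ} (ht : 1 < t) :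
    conj (uFun m σ₀ r lam t) = ((t ^ (r - σ₀ - 1) : ℝ) : ℂ)
      * (qPoly m (constA r) (r + σ₀ - 1 - lam)).eval (Real.log t : ℂ) := by
  rw [uFun_of_one_lt ht, map_mul, conj_ofReal, ← Q_eq_eval_qPoly, conj_Q]

lemma aestronglyMeasurable_uFun :
    AEStronglyMeasurable (uFun m σ₀ r lam) (volume.restrict (Ioi 0)) := by
  rw [show Ioi (0 : ℝ) = Ioc 0 1 ∪ Ioi 1 from (Ioc_union_Ioi_eq_Ioi zero_le_one).symm,
    aestronglyMeasurable_union_iff, ← restrict_Ioo_eq_restrict_Ioc]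
  constructor
  · refine ((((continuousOn_cpow_const_Ioi (conj lam - 2 * σ₀)).mono
      fun t (ht : t ∈ Ioo (0 : ℝ) 1) => ht.1).const_mul
      ((1 + constA r / constB σ₀ r lam) ^ m)).congr
        fun t ht => uFun_of_lt_one ht).aestronglyMeasurable measurableSet_Ioo
  · refine (((continuousOn_cpow_mul_eval_log ((r - σ₀ - 1 : ℝ) : ℂ)
      (qPoly m (constA r) (constB σ₀ r lam))).mono (Ioi_subset_Ioi zero_le_one)).congr
        fun t ht => ?_).aestronglyMeasurable measurableSet_Ioi
    rw [uFun_of_one_lt ht, ofReal_cpow (zero_le_one.trans (le_of_lt ht))]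

lemma memLp_uFun (hr : r < 1) (hlam : σ₀ < lam.re) :
    MemLp (uFun m σ₀ r lam) 2 (weightMeasure σ₀) := by
  refine memLp_weightMeasure aestronglyMeasurable_uFun ?_
    (integrableOn_sq_norm_of_tail hr fun t ht => uFun_of_one_lt ht)
  have h : IntegrableOn (fun t : ℝ => t ^ (2 * lam.re - 2 * σ₀ - 1)) (Ioo 0 1) :=
    ((intervalIntegral.integrableOn_Ioo_rpow_iff one_pos).2 (by linarith))
  refine (integrableOn_congr_fun (fun t ht => ?_) measurableSet_Ioo).1
    (h.const_mul (‖(1 + constA r / constB σ₀ r lam) ^ m‖ ^ 2))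
  rw [uFun_of_lt_one ht, norm_mul, mul_pow, norm_cpow_eq_rpow_re_of_pos ht.1,
    ← Real.rpow_mul_natCast ht.1.le, mul_left_comm, ← Real.rpow_add ht.1]
  congr 2
  simp
  ring

/-- The functions `u_{r,λ}` have the Gram matrix of the reproducing kernels
`s ↦ 1 / (s - 2σ₀ + conj λ)` of the Hardy space of the half-plane. -/
lemma inner_uFun_uFun (hr : r < 1) (hlam : σ₀ < lam.re) (hμ : σ₀ < μ.re)
    (hμ1 : ((r - σ₀ : ℝ) : ℂ) + μ ≠ 1) :
    inner ℂ (toL2 σ₀ (uFun m σ₀ r μ)) (toL2 σ₀ (uFun m σ₀ r lam))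
      = 1 / (μ + conj lam - 2 * σ₀) := by
  have hA : constA r ≠ 0 := by
    have : constA r = ((2 - 2 * r : ℝ) : ℂ) := by simp [constA]
    rw [this, ofReal_ne_zero]
    linarith
  have hB : constB σ₀ r lam ≠ 0 := fun h => by
    have := congrArg re h
    simp [constB] at this
    linarith
  have hC : (r + σ₀ - 1 - μ : ℂ) ≠ 0 := fun h => by
    have := congrArg re h
    simp at this
    linarith
  have hAC : constA r + (r + σ₀ - 1 - μ) ≠ 0 := fun h => hμ1 (by
    rw [constA] at h
    push_cast
    linear_combination -h)
  have hκre : 0 < (μ + conj lam - 2 * σ₀ : ℂ).re := by simp; linarith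
  have hκ : (μ + conj lam - 2 * σ₀ : ℂ) ≠ 0 := fun h => by rw [h] at hκre; simp at hκre
  have hABC : constA r + constB σ₀ r lam + (r + σ₀ - 1 - μ) = -(μ + conj lam - 2 * σ₀) := by
    rw [constA, constB]; ring
  rw [inner_toL2 (memLp_uFun hr hμ) (memLp_uFun hr hlam),
    integral_tail hr (fun t ht => conj_uFun_of_one_lt ht) (fun t ht => uFun_of_one_lt ht),
    laplace_qPoly_mul_qPoly hA hB hC hAC (by rw [hABC]; exact neg_ne_zero.2 hκ), hABC]
  have h1 : ∫ t in Ioo (0 : ℝ) 1, ((t ^ (2 * σ₀ - 1) : ℝ) : ℂ)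
      * (conj (uFun m σ₀ r μ t) * uFun m σ₀ r lam t)
      = (1 + constA r / (r + σ₀ - 1 - μ)) ^ m * (1 + constA r / constB σ₀ r lam) ^ m
        * (1 / (μ + conj lam - 2 * σ₀)) := by
    have h2 : ∫ t in Ioo (0 : ℝ) 1, (t : ℂ) ^ (μ + conj lam - 2 * σ₀ - 1)
        = 1 / (μ + conj lam - 2 * σ₀) := by
      rw [← integral_Ioc_eq_integral_Ioo, ← intervalIntegral.integral_of_le zero_le_one,
        integral_cpow (Or.inl (by rw [sub_re, one_re]; linarith))]
      simp [hκ]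
    rw [← h2, ← integral_const_mul]
    refine setIntegral_congr_fun measurableSet_Ioo fun t ht => ?_
    have ht' : (t : ℂ) ≠ 0 := ofReal_ne_zero.2 ht.1.ne'
    rw [conj_uFun_of_lt_one ht, uFun_of_lt_one ht,
      show (μ + conj lam - 2 * σ₀ - 1 : ℂ)
        = ((2 * σ₀ - 1 : ℝ) : ℂ) + (μ - 2 * σ₀) + (conj lam - 2 * σ₀) by push_cast; ring,
      cpow_add _ _ ht', cpow_add _ _ ht', ofReal_cpow ht.1.le]
    ring
  rw [h1]
  field_simp
  ring

end Kernel

/-! ### Orthogonality to the dilates of `ψ` -/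

section Dilates

variable {a : ℕ → ℂ} {L : ℂ → ℂ} {φ : ℝ → ℂ} {σ₀ r₀ r : ℝ} {m : ℕ} {P : Polynomial ℂ} {α : ℝ}

/-- The function `t ↦ t^{r - σ₀} ψ(α / t)`. -/
def psiDilate (a : ℕ → ℂ) (L : ℂ → ℂ) (φ : ℝ → ℂ) (σ₀ r α : ℝ) (t : ℝ) : ℂ :=
  ((t ^ (r - σ₀) : ℝ) : ℂ) * psi a L φ (α / t)

lemma fA_eq_sum (A : FiniteSeq) :
    fA a L φ σ₀ r A = ∑ j, A.c j • psiDilate a L φ σ₀ r (A.α j) := by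
  ext t
  simp only [fA, psiDilate, Finset.sum_apply, Pi.smul_apply, smul_eq_mul, Finset.mul_sum]
  exact Finset.sum_congr rfl fun j _ => by ring

lemma psiDilate_of_one_lt (hα : α ∈ Ioc (0 : ℝ) 1)
    (hP : ∀ u : ℝ, 0 < u → psi a L φ u = u * P.eval (Real.log u : ℂ) - weightedSum a φ u)
    {t : ℝ} (ht : 1 < t) :
    psiDilate a L φ σ₀ r α t = ((t ^ (r - σ₀ - 1) : ℝ) : ℂ)
      * (Polynomial.C (α : ℂ) * (Polynomial.taylor (Real.log α : ℂ) P).comp (-Polynomial.X)).eval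
        (Real.log t : ℂ) := by
  have ht0 : 0 < t := one_pos.trans ht
  have h1 : α / t ≤ 1 := (div_le_one ht0).2 (hα.2.trans ht.le)
  rw [psiDilate, hP _ (div_pos hα.1 ht0), weightedSum_of_le_one a φ h1,
    Real.log_div hα.1.ne' ht0.ne', Real.rpow_sub_one ht0.ne', Polynomial.taylor_apply]
  simp only [Polynomial.eval_mul, Polynomial.eval_C, Polynomial.eval_comp, Polynomial.eval_neg,
    Polynomial.eval_X, Polynomial.eval_add, sub_zero]
  push_cast
  rw [show (Real.log α - Real.log t : ℂ) = -Real.log t + Real.log α by ring]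
  ring

lemma aestronglyMeasurable_psiDilate (hφ : IsWeight φ σ₀) (hα : α ∈ Ioc (0 : ℝ) 1)
    (hP : ∀ u : ℝ, 0 < u → psi a L φ u = u * P.eval (Real.log u : ℂ) - weightedSum a φ u) :
    AEStronglyMeasurable (psiDilate a L φ σ₀ r α) (volume.restrict (Ioi 0)) := by
  have h1 : Measurable fun t : ℝ => ((t ^ (r - σ₀) : ℝ) : ℂ) := by fun_prop
  exact h1.aestronglyMeasurable.mul ((aestronglyMeasurable_psi hφ hP).comp_quasiMeasurePreserving
    (quasiMeasurePreserving_const_div hα.1))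

lemma integrableOn_sq_psi (hφ : IsWeight φ σ₀) (hr₀r : r₀ ≤ r)
    (hψ : IntegrableOn (fun t : ℝ => ‖psi a L φ t‖ ^ 2 / t ^ (1 + 2 * r₀)) (Ioi 1))
    (hP : ∀ u : ℝ, 0 < u → psi a L φ u = u * P.eval (Real.log u : ℂ) - weightedSum a φ u)
    (hα : α ∈ Ioc (0 : ℝ) 1) :
    IntegrableOn (fun u => u ^ (-(1 + 2 * r)) * ‖psi a L φ u‖ ^ 2) (Ioi α) := by
  have hpow : ContinuousOn (fun u : ℝ => u ^ (-(1 + 2 * r))) (Ioi 0) := fun u (hu : 0 < u) =>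
    (Real.continuousAt_rpow_const _ _ (Or.inl hu.ne')).continuousWithinAt
  rw [← Ioc_union_Ioi_eq_Ioi hα.2, integrableOn_union]
  constructor
  · have hsub : Icc α 1 ⊆ Ioc 0 1 := fun u hu => ⟨hα.1.trans_le hu.1, hu.2⟩
    exact (((hpow.mono fun u hu => (hsub hu).1).mul
      (((continuousOn_psi_Ioc hP).mono hsub).norm.pow 2)).integrableOn_Icc).mono_set
        Ioc_subset_Icc_self
  · refine hψ.mono' (((hpow.mono (Ioi_subset_Ioi zero_le_one)).aestronglyMeasurable
      measurableSet_Ioi).mul (((aestronglyMeasurable_psi hφ hP).mono_set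
        (Ioi_subset_Ioi zero_le_one)).norm.pow 2)) ?_
    filter_upwards [ae_restrict_mem measurableSet_Ioi] with u hu
    have hu1 : 1 < u := hu
    have hu0 : 0 < u := one_pos.trans hu1
    rw [Real.norm_of_nonneg (by positivity), div_eq_mul_inv, ← Real.rpow_neg hu0.le, mul_comm]
    exact mul_le_mul_of_nonneg_left (Real.rpow_le_rpow_of_exponent_le hu1.le (by linarith))
      (by positivity)

lemma memLp_psiDilate (hφ : IsWeight φ σ₀) (hr₀r : r₀ ≤ r) (hr : r < 1)
    (hψ : IntegrableOn (fun t : ℝ => ‖psi a L φ t‖ ^ 2 / t ^ (1 + 2 * r₀)) (Ioi 1))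
    (hP : ∀ u : ℝ, 0 < u → psi a L φ u = u * P.eval (Real.log u : ℂ) - weightedSum a φ u)
    (hα : α ∈ Ioc (0 : ℝ) 1) :
    MemLp (psiDilate a L φ σ₀ r α) 2 (weightMeasure σ₀) := by
  refine memLp_weightMeasure (aestronglyMeasurable_psiDilate hφ hα hP) ?_
    (integrableOn_sq_norm_of_tail hr fun t ht => psiDilate_of_one_lt hα hP ht)
  rw [integrableOn_Ioo_iff_comp_const_div hα.1]
  refine (integrableOn_congr_fun (fun u hu => ?_) measurableSet_Ioi).1
    ((integrableOn_sq_psi hφ hr₀r hψ hP hα).const_mul (α ^ (2 * r)))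
  have hu0 : 0 < u := hα.1.trans hu
  have h1 : α / (α / u) = u := by have := hα.1.ne'; field_simp
  simp only [psiDilate]
  rw [h1, norm_mul, mul_pow, norm_real, Real.norm_of_nonneg (by have := hα.1; positivity),
    ← Real.rpow_mul_natCast (by have := hα.1; positivity), ← mul_assoc, ← mul_assoc, ← mul_assoc]
  congr 1
  have h2 : α / u ^ 2 = (α / u) * u ^ (-1 : ℝ) := by
    rw [Real.rpow_neg_one]; field_simp
  rw [h2, mul_assoc (α / u * _), ← Real.rpow_add (div_pos hα.1 hu0), mul_right_comm,
    mul_comm (α / u), ← Real.rpow_add_one (div_pos hα.1 hu0).ne', Real.div_rpow hα.1.le hu0.le,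
    div_eq_mul_inv, ← Real.rpow_neg hu0.le, mul_assoc, ← Real.rpow_add hu0]
  congr 2 <;> · push_cast; ring

/-- If `L` vanishes at `μ + r - σ₀`, then `u_{r,μ}` is orthogonal to the dilates of `ψ`. -/
lemma inner_uFun_psiDilate (hL : IsDirichletContinuation a L σ₀ m) (hφ : IsWeight φ σ₀)
    (hσr₀ : σ₀ < r₀) (hr₀r : r₀ ≤ r) (hr : r < 1)
    (hψ : IntegrableOn (fun t : ℝ => ‖psi a L φ t‖ ^ 2 / t ^ (1 + 2 * r₀)) (Ioi 1))
    (hPm : P ∈ Polynomial.degreeLT ℂ m)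
    (hP : ∀ u : ℝ, 0 < u → psi a L φ u = u * P.eval (Real.log u : ℂ) - weightedSum a φ u)
    (hα : α ∈ Ioc (0 : ℝ) 1) {μ : ℂ} (hμ : σ₀ < μ.re) (hμ1 : ((r - σ₀ : ℝ) : ℂ) + μ ≠ 1)
    (hzero : L (((r - σ₀ : ℝ) : ℂ) + μ) = 0) :
    inner ℂ (toL2 σ₀ (uFun m σ₀ r μ)) (toL2 σ₀ (psiDilate a L φ σ₀ r α)) = 0 := by
  set w : ℂ := ((r - σ₀ : ℝ) : ℂ) + μ with hw
  have hwre : r₀ < w.re := by simp [hw]; linarith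
  have hA : constA r ≠ 0 := by
    have : constA r = ((2 - 2 * r : ℝ) : ℂ) := by simp [constA]
    rw [this, ofReal_ne_zero]
    linarith
  have hC : (r + σ₀ - 1 - μ : ℂ) ≠ 0 := fun h => by
    have := congrArg re h
    simp at this
    linarith
  have hAC' : constA r + (r + σ₀ - 1 - μ) = -(w - 1) := by
    rw [constA, hw]; push_cast; ring
  have hAC : constA r + (r + σ₀ - 1 - μ) ≠ 0 := by
    rw [hAC']; exact neg_ne_zero.2 (sub_ne_zero.2 hμ1)
  have hα' : (α : ℂ) ≠ 0 := ofReal_ne_zero.2 hα.1.ne'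
  rw [inner_toL2 (memLp_uFun hr hμ) (memLp_psiDilate hφ hr₀r hr hψ hP hα),
    integral_tail hr (fun t ht => conj_uFun_of_one_lt ht)
      (fun t ht => psiDilate_of_one_lt hα hP ht)]
  have h1 : ∫ t in Ioo (0 : ℝ) 1, ((t ^ (2 * σ₀ - 1) : ℝ) : ℂ)
      * (conj (uFun m σ₀ r μ t) * psiDilate a L φ σ₀ r α t)
      = (1 + constA r / (r + σ₀ - 1 - μ)) ^ m
        * (α * laplace (w - 1) (Polynomial.taylor (Real.log α : ℂ) P)) := by
    -- Substitute `t = α / u`.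
    have h2 := integral_Ioi_psi_of_zero hL hφ hσr₀ (hr₀r.trans_lt hr) hψ hP hwre hμ1 hzero hα
    have h3 : (α : ℂ) * laplace (w - 1) (Polynomial.taylor (Real.log α : ℂ) P)
        = (α : ℂ) ^ w * ((α : ℂ) ^ (1 - w)
          * laplace (w - 1) (Polynomial.taylor (Real.log α : ℂ) P)) := by
      rw [← mul_assoc, ← cpow_add _ _ hα', add_sub_cancel, cpow_one]
    rw [h3, ← h2, ← mul_assoc, ← integral_const_mul, integral_Ioo_comp_const_div hα.1]
    refine setIntegral_congr_fun measurableSet_Ioi fun u hu => ?_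
    have hu0 : 0 < u := hα.1.trans hu
    have hu' : (u : ℂ) ≠ 0 := ofReal_ne_zero.2 hu0.ne'
    have hαu : 0 < α / u := div_pos hα.1 hu0
    have hαu' : ((α / u : ℝ) : ℂ) ≠ 0 := ofReal_ne_zero.2 hαu.ne'
    have hmem : α / u ∈ Ioo (0 : ℝ) 1 := ⟨hαu, (div_lt_one hu0).2 hu⟩
    have h4 : α / (α / u) = u := by have := hα.1.ne'; field_simp
    have h5 : ((α / u : ℝ) : ℂ) ^ w = (α : ℂ) ^ w * (u : ℂ) ^ (-w) := by
      rw [div_eq_mul_inv, ofReal_mul, mul_cpow_ofReal_nonneg hα.1.le (inv_nonneg.2 hu0.le),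
        cpow_neg, ofReal_inv, inv_cpow _ _ (by
          rw [arg_ofReal_of_nonneg hu0.le]; exact Real.pi_ne_zero.symm)]
    have h6 : ((α / u : ℝ) : ℂ) ^ w = ((α / u : ℝ) : ℂ) ^ (((2 * σ₀ - 1 : ℝ) : ℂ))
        * ((α / u : ℝ) : ℂ) ^ (μ - 2 * σ₀) * ((α / u : ℝ) : ℂ) ^ (((r - σ₀ : ℝ) : ℂ))
        * ((α / u : ℝ) : ℂ) := by
      rw [← cpow_add _ _ hαu', ← cpow_add _ _ hαu']
      nth_rewrite 3 [← cpow_one ((α / u : ℝ) : ℂ)]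
      rw [← cpow_add _ _ hαu']
      congr 1
      rw [hw]; push_cast; ring
    have h7 : ((α / u ^ 2 : ℝ) : ℂ) = ((α / u : ℝ) : ℂ) * (u : ℂ) ^ (-1 : ℂ) := by
      rw [cpow_neg_one]; push_cast; field_simp
    simp only [psiDilate]
    rw [h4, conj_uFun_of_lt_one hmem, sub_eq_add_neg (-w) 1, cpow_add _ _ hu',
      ofReal_cpow hαu.le, ofReal_cpow hαu.le, h7]
    linear_combination ((1 + constA r / (r + σ₀ - 1 - μ)) ^ m * (u : ℂ) ^ (-1 : ℂ)
      * psi a L φ u) * (h5 - h6)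
  have hTm : Polynomial.taylor (Real.log α : ℂ) P ∈ Polynomial.degreeLT ℂ m := by
    rw [Polynomial.mem_degreeLT] at hPm ⊢
    rwa [Polynomial.degree_taylor]
  have h8 := laplace_add_laplace_comp_neg_mul_qPoly hA hC hAC hTm
  rw [hAC', neg_neg] at h8
  rw [h1, mul_assoc, ← Polynomial.smul_eq_C_mul, map_smul, smul_eq_mul]
  linear_combination (α : ℂ) * h8

end Dilates

/-! ### The distance estimate -/

/-- Points of the disc lie to the right of the line `Re s = σ₀`: on the other side the quotient
has modulus at least `1`. -/
lemma re_gt_of_norm_div_lt_one {σ₀ : ℝ} {lam μ : ℂ} (hlam : σ₀ < lam.re)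
    (hne : μ + conj lam - 2 * σ₀ ≠ 0)
    (h : ‖(μ - lam) / (μ + conj lam - 2 * σ₀)‖ < 1) : σ₀ < μ.re := by
  rw [norm_div, div_lt_one (norm_pos_iff.2 hne), ← sq_lt_sq₀ (norm_nonneg _) (norm_nonneg _),
    ← normSq_eq_norm_sq, ← normSq_eq_norm_sq, normSq_apply, normSq_apply] at h
  simp at h
  nlinarith

lemma one_sub_norm_div_sq {σ₀ : ℝ} {lam μ : ℂ} (hne : μ + conj lam - 2 * σ₀ ≠ 0) :
    1 - ‖(μ - lam) / (μ + conj lam - 2 * σ₀)‖ ^ 2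
      = 4 * (lam.re - σ₀) * (μ.re - σ₀) * ‖1 / (μ + conj lam - 2 * σ₀)‖ ^ 2 := by
  have h0 : ‖μ + conj lam - 2 * σ₀‖ ^ 2 ≠ 0 := pow_ne_zero _ (norm_ne_zero_iff.2 hne)
  rw [norm_div, norm_div, norm_one, div_pow, div_pow, one_pow]
  field_simp
  rw [← normSq_eq_norm_sq, ← normSq_eq_norm_sq, normSq_apply, normSq_apply]
  simp
  ring

/-- A vector orthogonal to a subspace bounds distances to that subspace from below. -/
lemma norm_inner_le_norm_mul_infDist {E : Type*} [NormedAddCommGroup E] [InnerProductSpace ℂ E]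
    {S : Submodule ℂ E} {v : E} (hv : ∀ k ∈ S, inner ℂ v k = 0) (x : E) :
    ‖inner ℂ v x‖ ≤ ‖v‖ * Metric.infDist x (S : Set E) := by
  rcases eq_or_ne v 0 with rfl | hv0
  · simp
  rw [← div_le_iff₀' (norm_pos_iff.2 hv0), Metric.le_infDist ⟨0, S.zero_mem⟩]
  intro k hk
  rw [div_le_iff₀' (norm_pos_iff.2 hv0), dist_eq_norm]
  calc ‖inner ℂ v x‖ = ‖inner ℂ v (x - k)‖ := by rw [inner_sub_right, hv k hk, sub_zero]
    _ ≤ ‖v‖ * ‖x - k‖ := norm_inner_le_norm _ _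

end ZeroFree

end

theorem theorem5p4 (a : ℕ → ℂ) (L : ℂ → ℂ) (φ : ℝ → ℂ) (m : ℕ) (σ₀ r₀ r : ℝ) (lam : ℂ)
    (hL : ZeroFree.IsDirichletContinuation a L σ₀ m)
    (hφ : ZeroFree.IsWeight φ σ₀)
    (hσr₀ : σ₀ < r₀)
    (hψ : IntegrableOn (fun t : ℝ => ‖ZeroFree.psi a L φ t‖ ^ 2 / t ^ (1 + 2 * r₀)) (Ioi 1))
    (hr₀r : r₀ ≤ r) (hr : r < 1)
    (hlam : lam ∈ ZeroFree.halfPlane σ₀) :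
    -- all the functions involved are square integrable
    (∀ A : ZeroFree.FiniteSeq,
      MemLp (ZeroFree.fA a L φ σ₀ r A) 2 (ZeroFree.weightMeasure σ₀)) ∧
    MemLp (ZeroFree.uFun m σ₀ r lam) 2 (ZeroFree.weightMeasure σ₀) ∧
    -- the translated disc lies in the domain of `L` and, off the pole at `1`, `L` has no zero in it
    ∀ μ ∈ ZeroFree.disc a L φ m σ₀ r lam,
      ((r - σ₀ : ℝ) : ℂ) + μ ∈ ZeroFree.halfPlane σ₀ ∧
      (((r - σ₀ : ℝ) : ℂ) + μ ≠ 1 → L (((r - σ₀ : ℝ) : ℂ) + μ) ≠ 0) := by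
  open ZeroFree in
  have hlam : σ₀ < lam.re := hlam
  obtain ⟨P, hPm, hP⟩ := exists_psi_eq hL hφ
  refine ⟨fun A => ?_, memLp_uFun hr hlam, fun μ ⟨hne, hlt⟩ => ?_⟩
  · rw [fA_eq_sum]
    exact memLp_finsetSum' _ fun j _ =>
      (memLp_psiDilate hφ hr₀r hr hψ hP (A.α_mem j)).const_smul _
  have hμ : σ₀ < μ.re := by
    refine re_gt_of_norm_div_lt_one hlam hne (hlt.trans_le (Real.sqrt_le_one.2 ?_))
    have : 0 < lam.re - σ₀ := sub_pos.2 hlam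
    have := mul_nonneg (mul_nonneg zero_le_two this.le) (sq_nonneg (delta a L φ m σ₀ r lam))
    linarith
  refine ⟨?_, fun hμ1 hzero => ?_⟩
  · have : σ₀ < (((r - σ₀ : ℝ) : ℂ) + μ).re := by
      rw [add_re, ofReal_re]; linarith
    exact this
  -- At a zero of `L` the vector `v` is orthogonal to `K`, and the distance from `u_{r,λ}` to `K` is
  -- at least the length of the projection of `u_{r,λ}` onto `v`.
  set v := toL2 σ₀ (uFun m σ₀ r μ) with hv
  have horth : ∀ k ∈ K a L φ σ₀ r, inner ℂ v k = 0 := by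
    have hle : K a L φ σ₀ r ≤ (Submodule.span ℂ {v})ᗮ := by
      refine Submodule.topologicalClosure_minimal _ (Submodule.span_le.2 ?_)
        (Submodule.isClosed_orthogonal _)
      rintro _ ⟨A, rfl⟩
      rw [SetLike.mem_coe, Submodule.mem_orthogonal_singleton_iff_inner_right]
      simp only [fA_eq_sum]
      exact inner_toL2_sum_eq_zero _ _ _ v
        (fun j => memLp_psiDilate hφ hr₀r hr hψ hP (A.α_mem j))
        fun j => inner_uFun_psiDilate hL hφ hσr₀ hr₀r hr hψ hPm hP (A.α_mem j) hμ hμ1 hzero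
    exact fun k hk => Submodule.mem_orthogonal_singleton_iff_inner_right.1 (hle hk)
  have hCS := norm_inner_le_norm_mul_infDist horth (toL2 σ₀ (uFun m σ₀ r lam))
  rw [inner_uFun_uFun hr hlam hμ hμ1] at hCS
  change _ ≤ ‖v‖ * delta a L φ m σ₀ r lam at hCS
  have hnorm : 2 * (μ.re - σ₀) * ‖v‖ ^ 2 = 1 := by
    have h1 : ((‖v‖ ^ 2 : ℝ) : ℂ) = 1 / (μ + conj μ - 2 * σ₀) := by
      rw [← inner_uFun_uFun (m := m) hr hμ hμ hμ1, ofReal_pow]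
      exact (inner_self_eq_norm_sq_to_K v).symm
    have h2 : μ + conj μ - 2 * σ₀ = ((2 * (μ.re - σ₀) : ℝ) : ℂ) := by
      rw [add_conj]; push_cast; ring
    rw [h2, ← ofReal_one, ← ofReal_div, ofReal_inj] at h1
    rw [h1]
    have : μ.re - σ₀ ≠ 0 := (sub_pos.2 hμ).ne'
    field_simp
  have hsq := pow_le_pow_left₀ (norm_nonneg _) hCS 2
  have hid := one_sub_norm_div_sq hne
  have hlt2 := (Real.lt_sqrt (norm_nonneg _)).1 hlt
  have hpos : 0 ≤ 4 * (lam.re - σ₀) * (μ.re - σ₀) :=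
    mul_nonneg (mul_nonneg zero_le_four (sub_pos.2 hlam).le) (sub_pos.2 hμ).le
  have h3 := mul_le_mul_of_nonneg_left hsq hpos
  have h4 : 4 * (lam.re - σ₀) * (μ.re - σ₀) * (‖v‖ * delta a L φ m σ₀ r lam) ^ 2
      = 2 * (lam.re - σ₀) * delta a L φ m σ₀ r lam ^ 2 := by
    linear_combination (2 * (lam.re - σ₀) * delta a L φ m σ₀ r lam ^ 2) * hnorm
  linarith
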